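/- **Problem and network.** Let $f_1,\dots,f_n:\mathbb R^d\to\mathbb R$ ($n\ge 1$) be convex and $M$-Lipschitz ($M\ge 0$), let $r>0$, and let $x^*$ be a minimizer of $p(x)=\frac1n\sum_{i=1}^n f_i(x)+\frac r2\|x\|^2$. Let $\hat\nabla f_i(x)\in\partial f_i(x)$ be subgradient oracles. Let $\mathcal E(\tau)\subset\{1,\dots,n\}^2$ and $\mathbf W(\tau)\in\mathbb R^{n\times n}$, $\tau\ge 0$, be the links and the gossip matrix of a time-varying network: $\mathbf W(\tau)_{ij}=0$ if $i\ne j$ and $(j,i)\notin\mathcal E(\tau)$; $\mathbf W(\tau)\mathbf 1_n=0$ and $\mathbf W(\tau)^\top\mathbf 1_n=0$; and, for some $\chi\ge1$, $\|\mathbf W(\tau)x-x\|^2\le(1-1/\chi)\|x\|^2$ for all $\tau\ge 0$ and all $x\in\mathbb R^n$ with $\sum_i x_i=0$. **Algorithm 1** works on stacked vectors in $(\mathbb R^d)^n$. Put $r_x=\frac23 r$, $r_{yz}=3/r$. Start from $x^0=y^0=z^0=m^0=0$, with $\bar x^0=x^0$, $\bar y^0=y^0$, $\bar z^0=z^0$,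 $\tilde x^0=x^{-1}=x^0$. For $k=0,\dots,K-1$: 1. $\underline y^k=\alpha_ky^k+(1-\alpha_k)\bar y^k$, $\underline z^k=\alpha_kz^k+(1-\alpha_k)\bar z^k$, $g_y^k=g_z^k=r_{yz}(\underline y^k+\underline z^k)$; 2. (one decentralized communication) $\tilde g_z^k=(\mathbf W_k\otimes\mathbf I_d)g_z^k$, $\hat g_z^k=(\mathbf W_k\otimes\mathbf I_d)(g_z^k+m^k)$, where $\mathbf W_k=\mathbf W(\tau_k)$ and $\tau_k\ge0$ is the current time; 3. $\hat x^{k+1}=x^k+\gamma_k(\tilde x^k-x^{k-1})$, $y^{k+1}=y^k-\eta_y^k(g_y^k+\hat x^{k+1})$, $z^{k+1}=z^k-\eta_z^k\hat g_z^k$; 4. $\bar y^{k+1}=\underline y^k+\alpha_k(y^{k+1}-y^k)$, $\bar z^{k+1}=\underline z^k-\theta_z^k\tilde g_z^k$, $m^{k+1}=(\eta_z^k/\eta_z^{k+1})(m^k+g_z^k-\hat g_z^k)$; 5. $x^{k,0}=x^k$, and for $t=0,\dots,T-1$ (one subgradient computation by each node): $g_x^{k,t}=(\hat\nabla f_1(x_1^{k,t}),\dots,\hat\nabla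 f_n(x_n^{k,t}))$ and $x^{k,t+1}$ is the solution of $x^{k,t+1}=x^{k,t}-\eta_x^k\big(g_x^{k,t}+\beta_kx^{k,t+1}-y^{k+1}+\tau_x^k(x^{k,t+1}-x^k)\big)$; 6. $\tilde x^{k+1}=\frac1T\sum_{t=1}^Tx^{k,t}$, $x^{k+1}=\sigma_kx^{k,T}+(1-\sigma_k)\tilde x^{k+1}$, $\bar x^{k+1}=\alpha_k\tilde x^{k+1}+(1-\alpha_k)\bar x^k$. The output is $x_o^K=\frac1n\sum_{i=1}^nx_{a,i}^K$, where $x_a^K=(\sum_{k=1}^K\lambda_k)^{-1}\sum_{k=1}^K\lambda_k\bar x^k$. The parameters are $\alpha_k=\frac3{k+3}$, $\gamma_k=\frac{k+2}{k+3}$, $\beta_k=r_x$, $\tau_x^k=\frac{r_x}{2\alpha_k}$, $\sigma_k=\frac{\tau_x^k}{2\tau_x^k+\beta_k}$, $\eta_x^k=\frac1{\tau_x^kT}$, $\eta_y^k=\frac1{4r_{yz}\alpha_k}$, $\eta_z^k=\frac1{10r_{yz}\chi^2\alpha_k}$, $\theta_z^k=\frac1{2r_{yz}}$, $\lambda_K=\alpha_{K-1}^{-2}$,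 and $\lambda_k=\alpha_{k-1}^{-2}+\alpha_k^{-1}-\alpha_k^{-2}$ for $1\le k<K$. **Theorem.** There is an absolute constant $C>0$ such that for all $M\ge0$, $r>0$, $\chi\ge1$, $\epsilon>0$ there are integers $K,T\ge1$, depending only on $M,r,\chi,\epsilon$, such that for every problem, oracles, network and times $\tau_k\ge 0$ as above, Algorithm 1 makes $K$ decentralized communications and $K\times T$ subgradient computations (per node) and its output satisfies $p(x_o^K)-p(x^*)\le\epsilon$, where $$K\le C\,\frac{\chi M}{\sqrt{r\epsilon}}+1,\qquad K\times T\le C\,\frac{M^2}{r\epsilon}+K .$$ Moreover, if $\chi\sqrt{r\epsilon}\le M$, then $K\le C\frac{\chi M}{\sqrt{r\epsilon}}$ and $K\times T\le C\frac{M^2}{r\epsilon}$, that is, $K=\mathcal O\big(\frac{\chi M}{\sqrt{r\epsilon}}\big)$ and $K\times T=\mathcal O\big(\frac{M^2}{r\epsilon}\big)$. -/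

import Mathlib

namespace DecOpt

/-- The space `ℝ^d` with the Euclidean norm. -/
abbrev Vec (d : ℕ) : Type := EuclideanSpace ℝ (Fin d)

/-- The space `(ℝ^d)^n` of stacked vectors `x = (x_1, …, x_n)` with the Euclidean norm. -/
abbrev Stack (n d : ℕ) : Type := PiLp 2 (fun _ : Fin n => Vec d)

/-- The objective `p(x) = (1/n) ∑ i, f_i(x) + (r/2) ‖x‖²`. -/
noncomputable def objective {n d : ℕ} (f : Fin n → Vec d → ℝ) (r : ℝ) (x : Vec d) : ℝ :=
  (1 / (n : ℝ)) * ∑ i, f i x + r / 2 * ‖x‖ ^ 2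

/-- `g i` is a subgradient oracle of `f i` for every node `i`. -/
def IsSubgradientOracle {n d : ℕ} (f : Fin n → Vec d → ℝ) (g : Fin n → Vec d → Vec d) : Prop :=
  ∀ i x x', f i x + inner ℝ (g i x) (x' - x) ≤ f i x'

/-- `W τ` is a gossip matrix of the network with the set of links `E τ`, at all times `τ ≥ 0`. -/
structure IsGossip {n : ℕ} (E : ℝ → Set (Fin n × Fin n)) (W : ℝ → Matrix (Fin n) (Fin n) ℝ) :
    Prop where
  eq_zero : ∀ τ, 0 ≤ τ → ∀ i j, i ≠ j → (j, i) ∉ E τ → W τ i j = 0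
  mulVec_one : ∀ τ, 0 ≤ τ → Matrix.mulVec (W τ) (fun _ => 1) = 0
  transpose_mulVec_one : ∀ τ, 0 ≤ τ → Matrix.mulVec (W τ).transpose (fun _ => 1) = 0

/-- `χ` is a condition number of the network:
`‖W(τ) x - x‖² ≤ (1 - 1/χ) ‖x‖²` for all `x ∈ ℝ^n` with zero sum and all `τ ≥ 0`. -/
def HasConditionNumber {n : ℕ} (W : ℝ → Matrix (Fin n) (Fin n) ℝ) (χ : ℝ) : Prop :=
  ∀ τ, 0 ≤ τ → ∀ x : Fin n → ℝ, ∑ i, x i = 0 →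
    ∑ i, (Matrix.mulVec (W τ) x i - x i) ^ 2 ≤ (1 - 1 / χ) * ∑ i, x i ^ 2

/-- The product `(W ⊗ I_d) x`, written in blocks. -/
noncomputable def gossipMul {n d : ℕ} (W : Matrix (Fin n) (Fin n) ℝ) (x : Stack n d) :
    Stack n d :=
  WithLp.toLp 2 (fun i => ∑ j, W i j • x j)

/-- The function `G(y,z) = (r_yz / 2) ‖y + z‖²`. -/
noncomputable def G {n d : ℕ} (ryz : ℝ) (y z : Stack n d) : ℝ := ryz / 2 * ‖y + z‖ ^ 2

/-- The common value of `∇_y G(y,z)` and `∇_z G(y,z)`; see the next two lemmas. -/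
noncomputable def gradG {n d : ℕ} (ryz : ℝ) (y z : Stack n d) : Stack n d := ryz • (y + z)

theorem hasGradientAt_G_left {n d : ℕ} (ryz : ℝ) (y z : Stack n d) :
    HasGradientAt (fun y => G ryz y z) (gradG ryz y z) y := by
  rw [hasGradientAt_iff_hasFDerivAt]
  have h := (((hasFDerivAt_id y).add_const z).norm_sq).const_mul (ryz / 2)
  refine h.congr_fderiv ?_
  ext v
  simp [gradG]
  ring

theorem hasGradientAt_G_right {n d : ℕ} (ryz : ℝ) (y z : Stack n d) :
    HasGradientAt (fun z => G ryz y z) (gradG ryz y z) z := by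
  have h := hasGradientAt_G_left ryz z y
  simpa [G, gradG, add_comm] using h

/-- The parameters of the algorithm; `lam k` is used for `k = 1, …, K`, the others for
`k = 0, 1, …, K-1`. -/
structure Params where
  (α β γ σ lam τx ηx ηy ηz θz : ℕ → ℝ)

/-- The variables of the algorithm at the start of an outer iteration `k`: here `xPrev` is
`x^{k-1}`, `xTilde` is `x̃^k`, and `xBar`, `yBar`, `zBar` are the overlined sequences.
`comms` counts the decentralized communications made so far, and `subgrads` the subgradient
computations made so far by each node. -/
structure State (n d : ℕ) where
  (x xPrev xTilde xBar y yBar z zBar m : Stack n d)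
  (comms subgrads : ℕ)

/-- The initial state. There is no `x^{-1}`, `x̃^0` or overlined vector in the input:
`x^{-1} = x̃^0 = x^0` (no extrapolation in the first iteration), and the overlined sequences
start at `x^0`, `y^0`, `z^0`. -/
def State.init {n d : ℕ} (x0 y0 z0 m0 : Stack n d) : State n d where
  x := x0
  xPrev := x0
  xTilde := x0
  xBar := x0
  y := y0
  yBar := y0
  z := z0
  zBar := z0
  m := m0
  comms := 0
  subgrads := 0

/-- The variables of the inner loop: the point `x^{k,t}` and the number of subgradients that each
node has computed so far in this loop. -/
structure InnerState (n d : ℕ) where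
  point : Stack n d
  calls : ℕ

/-- All nodes query their oracles: `(g_1(x_1), …, g_n(x_n))`. -/
def oracleCall {n d : ℕ} (g : Fin n → Vec d → Vec d) (x : Stack n d) : Stack n d :=
  WithLp.toLp 2 (fun i => g i (x i))

/-- The unique solution `x'` of
`x' = x - η (gx + β x' - y + τ (x' - xk))`; see the next lemma. -/
noncomputable def proxStep {n d : ℕ} (η β τ : ℝ) (gx y xk x : Stack n d) : Stack n d :=
  (1 + η * (β + τ))⁻¹ • (x - η • (gx - y - τ • xk))

theorem eq_proxStep_iff {n d : ℕ} {η β τ : ℝ} (hη : 0 ≤ η) (hβ : 0 ≤ β) (hτ : 0 ≤ τ)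
    (gx y xk x x' : Stack n d) :
    x' = proxStep η β τ gx y xk x ↔ x' = x - η • (gx + β • x' - y + τ • (x' - xk)) := by
  have h : (1 + η * (β + τ)) ≠ 0 := by positivity
  rw [proxStep, eq_inv_smul_iff₀ h, ← sub_eq_zero, ← sub_eq_zero (a := x')]
  have e : (1 + η * (β + τ)) • x' - (x - η • (gx - y - τ • xk))
      = x' - (x - η • (gx + β • x' - y + τ • (x' - xk))) := by
    module
  rw [e]

/-- The inner loop at outer iteration with `x^k = xk` and `y^{k+1} = y`, after `t` steps. -/
noncomputable def innerLoop {n d : ℕ} (g : Fin n → Vec d → Vec d) (η β τ : ℝ) (y xk : Stack n d) :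
    ℕ → InnerState n d
  | 0 => ⟨xk, 0⟩
  | t + 1 =>
    let s := innerLoop g η β τ y xk t
    ⟨proxStep η β τ (oracleCall g s.point) y xk s.point, s.calls + 1⟩

/-- One outer iteration of the algorithm. The matrix `W` is the gossip matrix at the time of the
iteration; both products with it are formed in the same communication round. -/
noncomputable def step {n d : ℕ} (P : Params) (ryz : ℝ) (g : Fin n → Vec d → Vec d) (T : ℕ)
    (W : Matrix (Fin n) (Fin n) ℝ) (k : ℕ) (s : State n d) : State n d :=
  let yU := P.α k • s.y + (1 - P.α k) • s.yBar
  let zU := P.α k • s.z + (1 - P.α k) • s.zBar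
  let gy := gradG ryz yU zU
  let gz := gradG ryz yU zU
  let gzTilde := gossipMul W gz
  let gzHat := gossipMul W (gz + s.m)
  let xHat := s.x + P.γ k • (s.xTilde - s.xPrev)
  let y' := s.y - P.ηy k • (gy + xHat)
  let z' := s.z - P.ηz k • gzHat
  let yBar' := yU + P.α k • (y' - s.y)
  let zBar' := zU - P.θz k • gzTilde
  let m' := (P.ηz k / P.ηz (k + 1)) • (s.m + gz - gzHat)
  let loop := innerLoop g (P.ηx k) (P.β k) (P.τx k) y' s.x
  let xTilde' := (1 / (T : ℝ)) • ∑ t ∈ Finset.Icc 1 T, (loop t).point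
  let x' := P.σ k • (loop T).point + (1 - P.σ k) • xTilde'
  { x := x'
    xPrev := s.x
    xTilde := xTilde'
    xBar := P.α k • xTilde' + (1 - P.α k) • s.xBar
    y := y'
    yBar := yBar'
    z := z'
    zBar := zBar'
    m := m'
    comms := s.comms + 1
    subgrads := s.subgrads + (loop T).calls }

/-- The state after `k` outer iterations; `Wseq k` is the gossip matrix used in iteration `k`. -/
noncomputable def iterate {n d : ℕ} (P : Params) (ryz : ℝ) (g : Fin n → Vec d → Vec d) (T : ℕ)
    (Wseq : ℕ → Matrix (Fin n) (Fin n) ℝ) (s0 : State n d) : ℕ → State n d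
  | 0 => s0
  | k + 1 => step P ryz g T (Wseq k) k (iterate P ryz g T Wseq s0 k)

/-- The result of a run: the output vector `x_o^K`, the number of decentralized communications,
and the number of subgradient computations (of each node). -/
structure Result (d : ℕ) where
  point : Vec d
  comms : ℕ
  subgrads : ℕ

/-- The algorithm with `K` outer and `T` inner iterations. -/
noncomputable def algorithm {n d : ℕ} (P : Params) (ryz : ℝ) (g : Fin n → Vec d → Vec d)
    (K T : ℕ) (Wseq : ℕ → Matrix (Fin n) (Fin n) ℝ) (x0 y0 z0 m0 : Stack n d) : Result d :=
  let it := iterate P ryz g T Wseq (State.init x0 y0 z0 m0)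
  let xa : Stack n d :=
    (∑ k ∈ Finset.Icc 1 K, P.lam k)⁻¹ • ∑ k ∈ Finset.Icc 1 K, P.lam k • (it k).xBar
  { point := (1 / (n : ℝ)) • ∑ i, xa i
    comms := (it K).comms
    subgrads := (it K).subgrads }

/-- The constant `r_x`; it satisfies `r_x + 1 / r_yz = r`. -/
noncomputable def rX (r : ℝ) : ℝ := 2 / 3 * r

/-- The constant `r_yz`. -/
noncomputable def rYZ (r : ℝ) : ℝ := 3 / r

/-- `α_k = 3 / (k + 3)`. -/
noncomputable def alpha (k : ℕ) : ℝ := 3 / ((k : ℝ) + 3)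

/-- `τ_x^k = τ_x / α_k` with `τ_x = r_x / 2`. -/
noncomputable def tauX (r : ℝ) (k : ℕ) : ℝ := rX r / 2 * (alpha k)⁻¹

/-- The choice of all parameters, from `r`, `χ`, `K`, `T` only. -/
noncomputable def params (r χ : ℝ) (K T : ℕ) : Params where
  α := alpha
  β := fun _ => rX r
  γ := fun k => ((k : ℝ) + 2) / ((k : ℝ) + 3)
  σ := fun k => tauX r k / (2 * tauX r k + rX r)
  lam := fun k =>
    if k = K then (alpha (K - 1) ^ 2)⁻¹
    else (alpha (k - 1) ^ 2)⁻¹ + (alpha k)⁻¹ - (alpha k ^ 2)⁻¹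
  τx := tauX r
  ηx := fun k => 1 / (tauX r k * T)
  ηy := fun k => (4 * rYZ r)⁻¹ * (alpha k)⁻¹
  ηz := fun k => (10 * rYZ r * χ ^ 2)⁻¹ * (alpha k)⁻¹
  θz := fun _ => 1 / (2 * rYZ r)

end DecOpt

/-!
Write `F(x) = ∑ i, f_i(x_i)` on stacked vectors, and let `P` be the projection onto the orthogonal
complement of the consensus vectors (`disagreement`). As `r = r_x + 1/r_yz`, the problem is the saddle
point problem

  `min_x max_{y, P z = z} F(x) + r_x/2 ‖x‖² - ⟪y, x⟫ - r_yz/2 ‖y + z‖²`,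

and the algorithm is an accelerated primal-dual method for it.

* The inner loop is an inexact proximal step in `x` (`prox_subgradient_loop`), whose error is of order
  `M²n/(τ_x T)`.
* In `(y, z)` the quadratic `G` is minimized by Nesterov's method (`accelerated_quadratic_step`). Only
  the gossip matrix, not `P`, can be applied to the gradient. The auxiliary variable `m` collects the
  resulting error, so that `z` with a correction by `P m` performs exact projected steps
  (`error_feedback_step`); this costs the factor `χ²` in the step size.
* The extrapolation of `x` makes the bilinear coupling terms telescope.

Together these give `step_descent`: a potential decreases up to the error of the inner loop. After
summation with weights `λ_k`, whose sum is at least `K²/6`, the saddle gap of the averaged iterates is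
bounded for any comparison point (`averaged_gap_le`). The comparison point is the minimizer in `x`.
In `z` it is a multiple, of norm at most `M√n`, of the disagreement of the averaged primal iterate; it
penalizes this disagreement as strongly as the Lipschitz constants require, so the existence of
Lagrange multipliers is not needed. In `y` it is the point that linearizes `1/(2 r_yz) ‖x‖²` at the
minimizer. The lost quadratic term is recovered from the strong convexity of the objective.
The result is the bound `612 χ²M²/(rK²) + 108 M²/(rKT)` of `objective_output_le`, and both terms are at
most `ε/2` for `K ≥ 36 χM/√(rε)` and `KT ≥ 216 M²/(rε)`.
-/

namespace DecOpt

/-! ### Single steps in an abstract inner product space -/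

section InnerProductSpace

variable {H : Type*} [NormedAddCommGroup H] [InnerProductSpace ℝ H]

theorem convexOn_norm_sub_sq (u : H) : ConvexOn ℝ Set.univ (fun v : H => ‖v - u‖ ^ 2) := by
  have h := ((convexOn_univ_norm (E := H)).pow (fun _ _ => norm_nonneg _) 2).translate_left (-u)
  simpa [sub_eq_add_neg, Function.comp_def] using h

theorem norm_sub_sq_le_convexComb {s : ℝ} (h0 : 0 ≤ s) (h1 : s ≤ 1) (v w u : H) :
    ‖s • v + (1 - s) • w - u‖ ^ 2 ≤ s * ‖v - u‖ ^ 2 + (1 - s) * ‖w - u‖ ^ 2 := by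
  simpa using (convexOn_norm_sub_sq u).2 (Set.mem_univ v) (Set.mem_univ w) h0
    (sub_nonneg.2 h1) (by ring)

/-- Young's inequality with weight `c`. -/
theorem abs_inner_le_weighted {c : ℝ} (hc : 0 < c) (v w : H) :
    |inner ℝ v w| ≤ c * ‖v‖ ^ 2 + 1 / (4 * c) * ‖w‖ ^ 2 := by
  have h := abs_real_inner_le_norm v w
  have h2 : 0 ≤ (2 * c * ‖v‖ - ‖w‖) ^ 2 / (4 * c) := by positivity
  have h3 : (2 * c * ‖v‖ - ‖w‖) ^ 2 / (4 * c)
      = c * ‖v‖ ^ 2 + 1 / (4 * c) * ‖w‖ ^ 2 - ‖v‖ * ‖w‖ := by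
    field_simp; ring
  linarith

/-- One subgradient step that is explicit in `F` and implicit in the quadratic
`h v = β/2 ‖v‖² - ⟪y, v⟫ + τ/2 ‖v - xk‖²`, compared with an arbitrary point `u`. As `F` is not smooth,
evaluating its subgradient at `x` instead of `x'` costs `2ηL²`; the strong convexity of `h`
contributes `(β + τ)/2 ‖x' - u‖²`. -/
theorem prox_subgradient_step {F : H → ℝ} {g x x' y xk : H} {L η β τ : ℝ} (hη : 0 < η)
    (hsub : ∀ u, F x + inner ℝ g (u - x) ≤ F u) (hg : ‖g‖ ≤ L)
    (hLip : F x' - F x ≤ L * ‖x' - x‖)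
    (hx' : x' = x - η • (g + β • x' - y + τ • (x' - xk))) (u : H) :
    F x' + (β / 2 * ‖x'‖ ^ 2 - inner ℝ y x' + τ / 2 * ‖x' - xk‖ ^ 2)
        + (β + τ) / 2 * ‖x' - u‖ ^ 2 + 1 / (2 * η) * ‖x' - u‖ ^ 2
      ≤ F u + (β / 2 * ‖u‖ ^ 2 - inner ℝ y u + τ / 2 * ‖u - xk‖ ^ 2)
        + 1 / (2 * η) * ‖x - u‖ ^ 2 + 2 * η * L ^ 2 := by
  obtain ⟨e, rfl⟩ : ∃ e, u = x' - e := ⟨x' - u, by abel⟩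
  obtain ⟨q, rfl⟩ : ∃ q, xk = x' - q := ⟨x' - xk, by abel⟩
  obtain ⟨dx, rfl⟩ : ∃ dx, x = x' - dx := ⟨x' - x, by abel⟩
  have hdx : dx = -(η • (g + β • x' - y + τ • q)) := by
    have := hx'
    rw [sub_sub_cancel, sub_sub, eq_comm, sub_eq_self] at this
    exact eq_neg_of_add_eq_zero_left this
  have h1 : inner ℝ dx e
      = -(η * (inner ℝ g e + β * inner ℝ x' e - inner ℝ y e + τ * inner ℝ q e)) := by
    rw [hdx]
    simp only [inner_neg_left, inner_smul_left, inner_add_left, inner_sub_left]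
    simp
  have h2 := hsub (x' - e)
  have e1 : x' - e - (x' - dx) = dx - e := by abel
  have e2 : x' - (x' - e) = e := by abel
  have e3 : x' - (x' - dx) = dx := by abel
  have e4 : x' - (x' - q) = q := by abel
  have e5 : x' - e - (x' - q) = q - e := by abel
  have e6 : x' - dx - (x' - e) = e - dx := by abel
  rw [e1, inner_sub_right] at h2
  rw [e3] at hLip
  rw [e2, e4, e5, e6, norm_sub_sq_real x' e, norm_sub_sq_real q e, norm_sub_sq_real e dx,
    inner_sub_right, real_inner_comm dx e, h1]
  have h3 : -inner ℝ g dx ≤ L * ‖dx‖ := by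
    have := (abs_le.1 (abs_real_inner_le_norm g dx)).1
    have := mul_le_mul_of_nonneg_right hg (norm_nonneg dx)
    linarith
  -- the two first-order errors `L ‖dx‖` are absorbed by `‖dx‖² / (2η)`
  have h4 : 2 * (L * ‖dx‖) ≤ 1 / (2 * η) * ‖dx‖ ^ 2 + 2 * η * L ^ 2 := by
    have h5 : 0 ≤ (‖dx‖ - 2 * η * L) ^ 2 / (2 * η) := by positivity
    have h6 : (‖dx‖ - 2 * η * L) ^ 2 / (2 * η)
        = 1 / (2 * η) * ‖dx‖ ^ 2 + 2 * η * L ^ 2 - 2 * (L * ‖dx‖) := by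
      field_simp; ring
    linarith
  have h7 : 1 / (2 * η) * (‖e‖ ^ 2 - 2 * -(η * (inner ℝ g e + β * inner ℝ x' e - inner ℝ y e
      + τ * inner ℝ q e)) + ‖dx‖ ^ 2) = 1 / (2 * η) * ‖e‖ ^ 2 + (inner ℝ g e + β * inner ℝ x' e
      - inner ℝ y e + τ * inner ℝ q e) + 1 / (2 * η) * ‖dx‖ ^ 2 := by
    field_simp; ring
  rw [h7]
  linarith

/-- One accelerated step on `R/2 ‖y + z‖²`, with `a` in place of the gradient in the `z`
variable. The hypothesis `ha` says how much a step of length `1/(2R)` along `a` still decreases the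
function; it is the source of the negative term in `‖Pg‖²`. -/
theorem accelerated_quadratic_step {R α χ : ℝ} (hR : 0 < R) (hα : 0 ≤ α) (hα1 : α ≤ 1)
    {y z yb zb y' a Pg : H}
    (ha : 1 / (2 * χ) * ‖Pg‖ ^ 2 ≤
      inner ℝ (R • ((α • y + (1 - α) • yb) + (α • z + (1 - α) • zb))) a - 1 / 2 * ‖a‖ ^ 2)
    (v w : H) :
    R / 2 * ‖(α • y + (1 - α) • yb + α • (y' - y)) + (α • z + (1 - α) • zb - (1 / (2 * R)) • a)‖ ^ 2
      ≤ (1 - α) * (R / 2 * ‖yb + zb‖ ^ 2) + α * (R / 2 * ‖v + w‖ ^ 2)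
        + α * inner ℝ (R • ((α • y + (1 - α) • yb) + (α • z + (1 - α) • zb))) (y' - v)
        + α * inner ℝ (R • ((α • y + (1 - α) • yb) + (α • z + (1 - α) • zb))) (z - w)
        + R * α ^ 2 * ‖y' - y‖ ^ 2 - 1 / (4 * R * χ) * ‖Pg‖ ^ 2 := by
  set s := (α • y + (1 - α) • yb) + (α • z + (1 - α) • zb) with hs
  have e1 : (α • y + (1 - α) • yb + α • (y' - y)) + (α • z + (1 - α) • zb - (1 / (2 * R)) • a)
      = s + (α • (y' - y) - (1 / (2 * R)) • a) := by rw [hs]; abel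
  have hconv : ∀ p : H, R / 2 * ‖s‖ ^ 2 + R * inner ℝ s (p - s) ≤ R / 2 * ‖p‖ ^ 2 := by
    intro p
    have : ‖p‖ ^ 2 = ‖s‖ ^ 2 + 2 * inner ℝ s (p - s) + ‖p - s‖ ^ 2 := by
      rw [← norm_add_sq_real]; congr 2; abel
    rw [this]
    have : 0 ≤ R / 2 * ‖p - s‖ ^ 2 := by positivity
    linarith
  have h1 := mul_le_mul_of_nonneg_left (hconv (yb + zb)) (sub_nonneg.2 hα1)
  have h2 := mul_le_mul_of_nonneg_left (hconv (v + w)) hα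
  have h3 : (1 - α) * inner ℝ s (yb + zb - s) + α * inner ℝ s (v + w - s)
      = - (α * inner ℝ s (y - v) + α * inner ℝ s (z - w)) := by
    rw [← real_inner_smul_right, ← real_inner_smul_right, ← real_inner_smul_right,
      ← real_inner_smul_right, ← inner_add_right, ← inner_add_right, ← inner_neg_right]
    congr 1
    have : (1 - α) • (yb + zb - s) + α • (v + w - s)
        = (1 - α) • (yb + zb) + α • (v + w) - s := by module
    rw [this, hs]; module
  have h4 : ‖α • (y' - y) - (1 / (2 * R)) • a‖ ^ 2
      ≤ 2 * (α ^ 2 * ‖y' - y‖ ^ 2) + 2 * ((1 / (2 * R)) ^ 2 * ‖a‖ ^ 2) := by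
    have := parallelogram_law_with_norm ℝ (α • (y' - y)) ((1 / (2 * R)) • a)
    have h5 : ‖α • (y' - y)‖ ^ 2 = α ^ 2 * ‖y' - y‖ ^ 2 := by
      rw [norm_smul, mul_pow, Real.norm_eq_abs, sq_abs]
    have h6 : ‖(1 / (2 * R)) • a‖ ^ 2 = (1 / (2 * R)) ^ 2 * ‖a‖ ^ 2 := by
      rw [norm_smul, mul_pow, Real.norm_eq_abs, sq_abs]
    rw [← h5, ← h6]
    nlinarith [sq_nonneg ‖α • (y' - y) + (1 / (2 * R)) • a‖]
  have h5 : R / 2 * ‖α • (y' - y) - (1 / (2 * R)) • a‖ ^ 2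
      ≤ R * α ^ 2 * ‖y' - y‖ ^ 2 + 1 / (4 * R) * ‖a‖ ^ 2 := by
    calc _ ≤ R / 2 * (2 * (α ^ 2 * ‖y' - y‖ ^ 2) + 2 * ((1 / (2 * R)) ^ 2 * ‖a‖ ^ 2)) := by gcongr
      _ = _ := by field_simp; ring
  have h6 : 1 / (4 * R * χ) * ‖Pg‖ ^ 2 ≤ 1 / 2 * inner ℝ s a - 1 / (4 * R) * ‖a‖ ^ 2 := by
    rw [real_inner_smul_left] at ha
    have := mul_le_mul_of_nonneg_left ha (by positivity : 0 ≤ 1 / (2 * R))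
    calc _ = 1 / (2 * R) * (1 / (2 * χ) * ‖Pg‖ ^ 2) := by rw [← mul_assoc]; congr 1; field_simp; norm_num
      _ ≤ _ := this
      _ = _ := by field_simp; ring
  rw [e1, norm_add_sq_real, real_inner_smul_left, real_inner_smul_left]
  have h7 : inner ℝ s (α • (y' - y) - (1 / (2 * R)) • a)
      = α * inner ℝ s (y' - v) - α * inner ℝ s (y - v) - 1 / (2 * R) * inner ℝ s a := by
    rw [inner_sub_right, real_inner_smul_right, real_inner_smul_right,
      show y' - y = (y' - v) - (y - v) by abel, inner_sub_right s (y' - v)]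
    ring
  rw [h7]
  have h8 : R * (1 / (2 * R) * inner ℝ s a) = 1 / 2 * inner ℝ s a := by field_simp
  have h9 := congrArg (fun t => R * t) h3
  beta_reduce at h9
  linarith

/-- Gradient step along `A (g + m)` with error feedback. The shifted point `z - ηc • P m`,
`η = 1/(10Rχ²)`, follows exact projected gradient descent along `P g`. The price is the product of
`P g` with the accumulated error `P m`; that error contracts by the factor `1 - 1/(2χ)` up to
`2χ ‖P g‖²`, so the price is paid by `‖P m‖²` as a potential and by the `‖P g‖²` term that
`accelerated_quadratic_step` provides. -/
theorem error_feedback_step {R χ c c' : ℝ} (hR : 0 < R) (hχ : 1 ≤ χ) (hc : 0 < c) (hc' : 0 < c')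
    (P A : H →ₗ[ℝ] H) (hPsymm : ∀ u v, inner ℝ (P u) v = inner ℝ u (P v))
    (hPA : ∀ u, P (A u) = A u) (hAP : ∀ u, A (P u) = A u)
    (hA : ∀ u, ‖A (P u) - P u‖ ^ 2 ≤ (1 - 1 / χ) * ‖P u‖ ^ 2)
    (g m z w : H) (hz : P z = z) (hw : P w = w) :
    c * inner ℝ g (z - w)
      + 5 * R * χ ^ 2 * ‖(z - ((10 * R * χ ^ 2)⁻¹ * c) • A (g + m))
          - ((10 * R * χ ^ 2)⁻¹ * c') • P ((c / c') • (m + g - A (g + m))) - w‖ ^ 2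
      + (10 * R * χ ^ 2)⁻¹ / 2 * c' ^ 2 * ‖P ((c / c') • (m + g - A (g + m)))‖ ^ 2
    ≤ 5 * R * χ ^ 2 * ‖z - ((10 * R * χ ^ 2)⁻¹ * c) • P m - w‖ ^ 2
      + (10 * R * χ ^ 2)⁻¹ / 2 * c ^ 2 * ‖P m‖ ^ 2 + c ^ 2 * (1 / (4 * R * χ) * ‖P g‖ ^ 2) := by
  have hχ0 : 0 < χ := by linarith
  set η := (10 * R * χ ^ 2)⁻¹ with hη
  have hη0 : 0 < η := by positivity
  have h5 : 5 * R * χ ^ 2 = 1 / (2 * η) := by rw [hη]; field_simp; norm_num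
  rw [h5]
  have e1 : (z - (η * c) • A (g + m)) - (η * c') • P ((c / c') • (m + g - A (g + m))) - w
      = (z - (η * c) • P m - w) - (η * c) • P g := by
    have : (η * c') • P ((c / c') • (m + g - A (g + m)))
        = (η * c) • (P m + P g - A (g + m)) := by
      rw [map_smul, smul_smul, map_sub, map_add, hPA]
      congr 1; field_simp
    rw [this]; module
  have e2 : inner ℝ (z - (η * c) • P m - w) ((η * c) • P g)
      = η * c * (inner ℝ g (z - w) - η * c * inner ℝ (P m) (P g)) := by
    have h : inner ℝ (z - w) (P g) = inner ℝ g (z - w) := by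
      rw [← hPsymm, map_sub, hz, hw, real_inner_comm]
    rw [sub_right_comm, real_inner_smul_right, inner_sub_left, real_inner_smul_left, h]
  have e3 : ‖(η * c) • P g‖ ^ 2 = (η * c) ^ 2 * ‖P g‖ ^ 2 := by
    rw [norm_smul, mul_pow, Real.norm_eq_abs, sq_abs]
  have e4 : c' ^ 2 * ‖P ((c / c') • (m + g - A (g + m)))‖ ^ 2
      = c ^ 2 * ‖A (P (g + m)) - P (g + m)‖ ^ 2 := by
    have : P ((c / c') • (m + g - A (g + m))) = (c / c') • (-(A (P (g + m)) - P (g + m))) := by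
      rw [map_smul, map_sub, hPA, hAP, add_comm m g, neg_sub]
    rw [this, norm_smul, mul_pow, Real.norm_eq_abs, sq_abs, norm_neg]
    field_simp
  have h6 : ‖A (P (g + m)) - P (g + m)‖ ^ 2
      ≤ (1 - 1 / (2 * χ)) * ‖P m‖ ^ 2 + 2 * χ * ‖P g‖ ^ 2 := by
    have hρ : 0 ≤ 1 - 1 / χ := by
      rw [sub_nonneg, div_le_one hχ0]; exact hχ
    -- Young's inequality with the weights that leave a contraction after the factor `1 - 1/χ`
    have h7 : ‖P (g + m)‖ ^ 2
        ≤ (1 + 1 / (2 * χ)) * ‖P m‖ ^ 2 + (1 + 2 * χ) * ‖P g‖ ^ 2 := by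
      rw [map_add, norm_add_sq_real]
      have := (le_abs_self _).trans (abs_inner_le_weighted (c := χ) hχ0 (P g) (P m))
      have h8 : 1 / (2 * χ) = 2 * (1 / (4 * χ)) := by field_simp; norm_num
      rw [h8]; linarith
    refine (hA _).trans ((mul_le_mul_of_nonneg_left h7 hρ).trans ?_)
    have h9 : (1 - 1 / χ) * (1 + 1 / (2 * χ)) ≤ 1 - 1 / (2 * χ) := by
      have : (1 - 1 / χ) * (1 + 1 / (2 * χ)) = 1 - 1 / (2 * χ) - 1 / (2 * χ ^ 2) := by
        field_simp; ring
      have : 0 ≤ 1 / (2 * χ ^ 2) := by positivity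
      linarith
    have h10 : (1 - 1 / χ) * (1 + 2 * χ) ≤ 2 * χ := by
      have : (1 - 1 / χ) * (1 + 2 * χ) = 2 * χ - 1 - 1 / χ := by field_simp; ring
      have : 0 ≤ 1 / χ := by positivity
      linarith
    nlinarith [mul_le_mul_of_nonneg_right h9 (sq_nonneg ‖P m‖),
      mul_le_mul_of_nonneg_right h10 (sq_nonneg ‖P g‖)]
  have h7 : inner ℝ (P m) (P g) ≤ 1 / (4 * χ) * ‖P m‖ ^ 2 + χ * ‖P g‖ ^ 2 := by
    have := (le_abs_self _).trans (abs_inner_le_weighted (c := χ) hχ0 (P g) (P m))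
    rw [real_inner_comm]; linarith
  have h8 : η / 2 + 2 * η * χ ≤ 1 / (4 * R * χ) := by
    have : 1 / (4 * R * χ) = 5 / 2 * η * χ := by rw [hη]; field_simp; norm_num
    rw [this]; nlinarith
  rw [e1, norm_sub_sq_real, e2, e3, mul_assoc (η / 2), e4]
  have h9 : 1 / (2 * η) * (‖z - (η * c) • P m - w‖ ^ 2
      - 2 * (η * c * (inner ℝ g (z - w) - η * c * inner ℝ (P m) (P g)))
      + (η * c) ^ 2 * ‖P g‖ ^ 2)
      = 1 / (2 * η) * ‖z - (η * c) • P m - w‖ ^ 2 - c * inner ℝ g (z - w)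
        + η * c ^ 2 * inner ℝ (P m) (P g) + η / 2 * c ^ 2 * ‖P g‖ ^ 2 := by
    field_simp
    ring
  rw [h9]
  have h10 := mul_le_mul_of_nonneg_left h6 (by positivity : 0 ≤ η / 2 * c ^ 2)
  have h11 := mul_le_mul_of_nonneg_left h7 (by positivity : 0 ≤ η * c ^ 2)
  have h12 := mul_le_mul_of_nonneg_left h8 (by positivity : 0 ≤ c ^ 2 * ‖P g‖ ^ 2)
  have h13 : 1 / (2 * χ) = 2 * (1 / (4 * χ)) := by field_simp; norm_num
  rw [h13] at h10
  linarith

/-- The three-point identity for the step `y - (c/(4R)) q`. -/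
theorem gradient_step_identity {R c : ℝ} (hR : R ≠ 0) (y q v : H) :
    c * inner ℝ q (y - ((4 * R)⁻¹ * c) • q - v) + 2 * R * ‖y - ((4 * R)⁻¹ * c) • q - v‖ ^ 2
      + 2 * R * ‖y - ((4 * R)⁻¹ * c) • q - y‖ ^ 2 = 2 * R * ‖y - v‖ ^ 2 := by
  have e1 : y - ((4 * R)⁻¹ * c) • q - v = (y - v) - ((4 * R)⁻¹ * c) • q := by abel
  have e2 : y - ((4 * R)⁻¹ * c) • q - y = -(((4 * R)⁻¹ * c) • q) := by abel
  rw [e1, e2, norm_neg, norm_sub_sq_real, inner_sub_right, real_inner_smul_right,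
    real_inner_smul_right, norm_smul, mul_pow, Real.norm_eq_abs, sq_abs,
    real_inner_self_eq_norm_sq, real_inner_comm q]
  field_simp
  ring

/-- The gossip matrix behaves like an inexact projection: this is the condition number
inequality `‖A P u - P u‖² ≤ (1 - 1/χ) ‖P u‖²` with the square expanded. -/
theorem half_norm_sq_le_inner_sub {χ : ℝ} (P A : H →ₗ[ℝ] H)
    (hPsymm : ∀ u v, inner ℝ (P u) v = inner ℝ u (P v))
    (hPA : ∀ u, P (A u) = A u) (hAP : ∀ u, A (P u) = A u)
    (hA : ∀ u, ‖A (P u) - P u‖ ^ 2 ≤ (1 - 1 / χ) * ‖P u‖ ^ 2) (u : H) :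
    1 / (2 * χ) * ‖P u‖ ^ 2 ≤ inner ℝ u (A u) - 1 / 2 * ‖A u‖ ^ 2 := by
  have h := hA u
  rw [hAP, norm_sub_sq_real, ← hPsymm, hPA, real_inner_comm] at h
  have : 1 / (2 * χ) = 1 / χ / 2 := by rw [div_div, mul_comm]
  rw [this]; linarith

theorem prox_subgradient_loop_sum {F : H → ℝ} {g : H → H} {y xk : H} {p : ℕ → H} {L η β τ : ℝ}
    (hη : 0 < η) (hsub : ∀ x u, F x + inner ℝ (g x) (u - x) ≤ F u) (hg : ∀ x, ‖g x‖ ≤ L)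
    (hLip : ∀ x x', F x' - F x ≤ L * ‖x' - x‖)
    (hp : ∀ t, p (t + 1) = p t - η • (g (p t) + β • p (t + 1) - y + τ • (p (t + 1) - xk)))
    (u : H) (T : ℕ) :
    ∑ t ∈ Finset.Icc 1 T, (F (p t) + (β / 2 * ‖p t‖ ^ 2 - inner ℝ y (p t) + τ / 2 * ‖p t - xk‖ ^ 2)
        + (β + τ) / 2 * ‖p t - u‖ ^ 2) + 1 / (2 * η) * ‖p T - u‖ ^ 2
      ≤ T * (F u + (β / 2 * ‖u‖ ^ 2 - inner ℝ y u + τ / 2 * ‖u - xk‖ ^ 2) + 2 * η * L ^ 2)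
        + 1 / (2 * η) * ‖p 0 - u‖ ^ 2 := by
  induction T with
  | zero => simp
  | succ T ih =>
    rw [Finset.sum_Icc_succ_top (by omega)]
    have := prox_subgradient_step hη (hsub (p T)) (hg _) (hLip _ _) (hp T) u
    push_cast
    linarith

/-- The inner loop. Jensen's inequality is applied to the averaged point `xt`. The weight
`τ/(2τ + β)` merges the distance terms at the last point `p T` and at `xt` into one term at `x'`,
with factor `τ + β/2` instead of the factor `τ` of the initial distance; this increase permits the
growing weights of the outer iterations. -/
theorem prox_subgradient_loop {F : H → ℝ} {g : H → H} {y xk : H} {p : ℕ → H} {L β τ : ℝ}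
    (hβ : 0 ≤ β) (hτ : 0 < τ) {T : ℕ} (hT : 1 ≤ T) (hF : ConvexOn ℝ Set.univ F)
    (hsub : ∀ x u, F x + inner ℝ (g x) (u - x) ≤ F u) (hg : ∀ x, ‖g x‖ ≤ L)
    (hLip : ∀ x x', F x' - F x ≤ L * ‖x' - x‖) (hp0 : p 0 = xk)
    (hp : ∀ t, p (t + 1)
      = p t - (1 / (τ * T)) • (g (p t) + β • p (t + 1) - y + τ • (p (t + 1) - xk)))
    {xt x' : H} (hxt : xt = (1 / (T : ℝ)) • ∑ t ∈ Finset.Icc 1 T, p t)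
    (hx' : x' = (τ / (2 * τ + β)) • p T + (1 - τ / (2 * τ + β)) • xt) (u : H) :
    F xt + β / 2 * ‖xt‖ ^ 2 - inner ℝ y xt + τ / 2 * ‖xt - xk‖ ^ 2 + (τ + β / 2) * ‖x' - u‖ ^ 2
      ≤ F u + β / 2 * ‖u‖ ^ 2 - inner ℝ y u + τ * ‖xk - u‖ ^ 2 + 2 * L ^ 2 / (τ * T) := by
  have hT0 : (0 : ℝ) < T := by exact_mod_cast hT
  have hη : 0 < 1 / (τ * T) := by positivity
  have hsum := prox_subgradient_loop_sum hη hsub hg hLip hp u T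
  set ψ : H → ℝ := fun v => F v + (β / 2 * ‖v‖ ^ 2 - inner ℝ y v + τ / 2 * ‖v - xk‖ ^ 2)
        + (β + τ) / 2 * ‖v - u‖ ^ 2 with hψ
  have hconv : ConvexOn ℝ Set.univ ψ := by
    have h1 : ConvexOn ℝ Set.univ (fun v : H => β / 2 * ‖v‖ ^ 2) := by
      simpa using (convexOn_norm_sub_sq (0 : H)).smul (by positivity : 0 ≤ β / 2)
    have h2 : ConvexOn ℝ Set.univ (fun v : H => -inner ℝ y v) := by
      exact ((innerSL ℝ (-y)).toLinearMap.convexOn convex_univ).congr fun v _ => by simp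
    have h3 := (convexOn_norm_sub_sq xk).smul (by positivity : 0 ≤ τ / 2)
    have h4 := (convexOn_norm_sub_sq u).smul (by positivity : 0 ≤ (β + τ) / 2)
    refine ((hF.add ((h1.add h2).add h3)).add h4).congr fun v _ => ?_
    simp only [hψ, Pi.add_apply, smul_eq_mul, sub_eq_add_neg]
  have hJ : ψ xt ≤ 1 / (T : ℝ) * ∑ t ∈ Finset.Icc 1 T, ψ (p t) := by
    have := hconv.map_sum_le (t := Finset.Icc 1 T) (w := fun _ => 1 / (T : ℝ)) (p := p)
      (fun _ _ => by positivity) (by simp [hT0.ne']) (fun _ _ => Set.mem_univ _)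
    rw [← Finset.smul_sum, ← hxt] at this
    rwa [← Finset.smul_sum] at this
  have hσ : (τ + β / 2) * ‖x' - u‖ ^ 2
      ≤ τ / 2 * ‖p T - u‖ ^ 2 + (β + τ) / 2 * ‖xt - u‖ ^ 2 := by
    have h1 : τ / (2 * τ + β) ≤ 1 := by
      rw [div_le_one (by positivity)]; linarith
    have := mul_le_mul_of_nonneg_left
      (norm_sub_sq_le_convexComb (by positivity) h1 (p T) xt u) (by positivity : 0 ≤ τ + β / 2)
    rw [← hx'] at this
    refine this.trans (le_of_eq ?_)
    have h0 : 2 * τ + β ≠ 0 := by positivity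
    field_simp
    ring
  have h5 := mul_le_mul_of_nonneg_left hsum (by positivity : 0 ≤ 1 / (T : ℝ))
  have h6 : ∀ q : ℝ, 1 / (T : ℝ) * (1 / (2 * (1 / (τ * T))) * q) = τ / 2 * q := by
    intro q; field_simp
  have h7 : ∀ q : ℝ, 1 / (T : ℝ) * (T * q) = q := by intro q; field_simp
  have h8 : 2 * (1 / (τ * T)) * L ^ 2 = 2 * L ^ 2 / (τ * T) := by ring
  rw [mul_add, mul_add, h6, h6, h7, hp0, norm_sub_rev u xk, h8] at h5
  have h9 : ψ xt = F xt + (β / 2 * ‖xt‖ ^ 2 - inner ℝ y xt + τ / 2 * ‖xt - xk‖ ^ 2)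
        + (β + τ) / 2 * ‖xt - u‖ ^ 2 := rfl
  linarith

end InnerProductSpace

/-! ### Stacked vectors, disagreement and gossip -/

section Stack

variable {n d : ℕ}

theorem inner_stack (x y : Stack n d) : inner ℝ x y = ∑ i, inner ℝ (x i) (y i) :=
  PiLp.inner_apply x y

theorem norm_sq_stack (x : Stack n d) : ‖x‖ ^ 2 = ∑ i, ‖x i‖ ^ 2 :=
  PiLp.norm_sq_eq_of_L2 _ x

/-- The stacked vector all of whose blocks equal `v`. -/
def consensus (n : ℕ) (v : Vec d) : Stack n d := WithLp.toLp 2 (fun _ => v)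

/-- The orthogonal projection onto the orthogonal complement of the consensus vectors:
it subtracts from each block the mean of the blocks. -/
noncomputable def disagreement (n d : ℕ) : Stack n d →ₗ[ℝ] Stack n d where
  toFun x := WithLp.toLp 2 (fun i => x i - (1 / (n : ℝ)) • ∑ j, x j)
  map_add' x y := by
    ext i c
    simp [Finset.sum_add_distrib]
    ring
  map_smul' a x := by
    ext i c
    simp [← Finset.mul_sum]
    ring

/-- `x ↦ (W ⊗ I_d) x` as a linear map. -/
noncomputable def gossipMap (d : ℕ) (W : Matrix (Fin n) (Fin n) ℝ) : Stack n d →ₗ[ℝ] Stack n d where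
  toFun := gossipMul W
  map_add' x y := by
    ext i c
    simp [gossipMul, Finset.sum_add_distrib]
  map_smul' a x := by
    ext i c
    simp [gossipMul, Finset.mul_sum, mul_left_comm]

theorem disagreement_apply (x : Stack n d) (i : Fin n) :
    disagreement n d x i = x i - (1 / (n : ℝ)) • ∑ j, x j := rfl

theorem gossipMul_apply (W : Matrix (Fin n) (Fin n) ℝ) (x : Stack n d) (i : Fin n) :
    gossipMul W x i = ∑ j, W i j • x j := rfl

theorem inner_disagreement (x y : Stack n d) :
    inner ℝ (disagreement n d x) y = inner ℝ x (disagreement n d y) := by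
  simp only [inner_stack, disagreement_apply, inner_sub_left, inner_sub_right,
    real_inner_smul_left, real_inner_smul_right, Finset.sum_sub_distrib, ← Finset.mul_sum,
    sum_inner, inner_sum]
  rw [Finset.sum_comm]

theorem sum_disagreement (hn : 1 ≤ n) (x : Stack n d) : ∑ i, disagreement n d x i = 0 := by
  have : (n : ℝ) ≠ 0 := by positivity
  simp only [disagreement_apply, Finset.sum_sub_distrib, Finset.sum_const, Finset.card_univ,
    Fintype.card_fin, ← Nat.cast_smul_eq_nsmul ℝ, smul_smul]
  rw [mul_one_div_cancel this, one_smul, sub_self]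

theorem disagreement_eq_self {x : Stack n d} (hx : ∑ i, x i = 0) : disagreement n d x = x := by
  ext i : 1
  rw [disagreement_apply, hx, smul_zero, sub_zero]

/-- A vector in the range of `disagreement` is orthogonal to the consensus vectors. -/
theorem inner_consensus_eq_zero {z : Stack n d} (hn : 1 ≤ n) (hz : disagreement n d z = z)
    (v : Vec d) : inner ℝ z (consensus n v) = 0 := by
  have : inner ℝ z (consensus n v) = inner ℝ (∑ i, z i) v := by
    rw [inner_stack, sum_inner]; rfl
  rw [this, ← hz, sum_disagreement hn, inner_zero_left]

theorem norm_sq_consensus (v : Vec d) : ‖consensus n v‖ ^ 2 = n * ‖v‖ ^ 2 := by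
  rw [norm_sq_stack]; simp [consensus]

theorem disagreement_gossipMul {W : Matrix (Fin n) (Fin n) ℝ}
    (hW : Matrix.mulVec W.transpose (fun _ => 1) = 0) (x : Stack n d) :
    disagreement n d (gossipMul W x) = gossipMul W x := by
  apply disagreement_eq_self
  simp only [gossipMul_apply]
  rw [Finset.sum_comm]
  refine Finset.sum_eq_zero fun j _ => ?_
  rw [← Finset.sum_smul]
  have := congrFun hW j
  simp [Matrix.mulVec, dotProduct] at this
  rw [this, zero_smul]

theorem gossipMul_disagreement {W : Matrix (Fin n) (Fin n) ℝ}
    (hW : Matrix.mulVec W (fun _ => 1) = 0) (x : Stack n d) :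
    gossipMul W (disagreement n d x) = gossipMul W x := by
  ext i : 1
  simp only [gossipMul_apply, disagreement_apply, smul_sub, Finset.sum_sub_distrib]
  have := congrFun hW i
  simp [Matrix.mulVec, dotProduct] at this
  rw [← Finset.sum_smul, this, zero_smul, sub_zero]

theorem norm_sq_gossipMul_sub_le {W : Matrix (Fin n) (Fin n) ℝ} {χ : ℝ} (hn : 1 ≤ n)
    (hW : ∀ x : Fin n → ℝ, ∑ i, x i = 0 →
      ∑ i, (Matrix.mulVec W x i - x i) ^ 2 ≤ (1 - 1 / χ) * ∑ i, x i ^ 2) (x : Stack n d) :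
    ‖gossipMul W (disagreement n d x) - disagreement n d x‖ ^ 2
      ≤ (1 - 1 / χ) * ‖disagreement n d x‖ ^ 2 := by
  have hu := sum_disagreement hn x
  set u := disagreement n d x
  have hnorm : ∀ v : Stack n d, ‖v‖ ^ 2 = ∑ c, ∑ i, (v i c) ^ 2 := by
    intro v
    rw [norm_sq_stack, Finset.sum_comm]
    refine Finset.sum_congr rfl fun i _ => ?_
    rw [EuclideanSpace.real_norm_sq_eq]
  rw [hnorm, hnorm, Finset.mul_sum]
  refine Finset.sum_le_sum fun c _ => ?_
  have h0 : ∑ i, u i c = 0 := by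
    have := congrArg (fun v : Vec d => v c) hu
    simpa using this
  have := hW (fun i => u i c) h0
  simpa [gossipMul_apply, Matrix.mulVec, dotProduct] using this

/-- The separable function `F(x) = ∑ i, f_i(x_i)` on stacked vectors. -/
def separableSum (f : Fin n → Vec d → ℝ) (x : Stack n d) : ℝ := ∑ i, f i (x i)

theorem convexOn_separableSum {f : Fin n → Vec d → ℝ} (hf : ∀ i, ConvexOn ℝ Set.univ (f i)) :
    ConvexOn ℝ Set.univ (separableSum f) := by
  refine ⟨convex_univ, fun x _ y _ a b ha hb hab => ?_⟩
  simp only [separableSum, smul_eq_mul, Finset.mul_sum, ← Finset.sum_add_distrib]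
  exact Finset.sum_le_sum fun i _ => (hf i).2 (Set.mem_univ _) (Set.mem_univ _) ha hb hab

theorem separableSum_subgradient {f : Fin n → Vec d → ℝ} {g : Fin n → Vec d → Vec d}
    (hg : IsSubgradientOracle f g) (x u : Stack n d) :
    separableSum f x + inner ℝ (oracleCall g x) (u - x) ≤ separableSum f u := by
  simp only [separableSum, inner_stack, ← Finset.sum_add_distrib]
  exact Finset.sum_le_sum fun i _ => hg i (x i) (u i)

theorem sum_norm_le (x : Stack n d) : ∑ i, ‖x i‖ ≤ √n * ‖x‖ := by
  apply le_of_sq_le_sq _ (by positivity)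
  rw [mul_pow, Real.sq_sqrt (Nat.cast_nonneg n), norm_sq_stack]
  simpa using sq_sum_le_card_mul_sum_sq (s := Finset.univ) (f := fun i => ‖x i‖)

theorem separableSum_sub_le {f : Fin n → Vec d → ℝ} {M : ℝ} (hM : 0 ≤ M)
    (hf : ∀ i x x', |f i x - f i x'| ≤ M * ‖x - x'‖) (x x' : Stack n d) :
    separableSum f x' - separableSum f x ≤ M * √n * ‖x' - x‖ := by
  rw [separableSum, separableSum, ← Finset.sum_sub_distrib]
  calc _ ≤ ∑ i, M * ‖(x' - x) i‖ :=
        Finset.sum_le_sum fun i _ => (le_abs_self _).trans (hf i _ _)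
    _ = M * ∑ i, ‖(x' - x) i‖ := by rw [Finset.mul_sum]
    _ ≤ M * (√n * ‖x' - x‖) := by gcongr; exact sum_norm_le _
    _ = _ := by ring

theorem norm_subgradient_le {φ : Vec d → ℝ} {M : ℝ} (hM : 0 ≤ M)
    (hφ : ∀ x x', |φ x - φ x'| ≤ M * ‖x - x'‖)
    {x v : Vec d} (hv : ∀ x', φ x + inner ℝ v (x' - x) ≤ φ x') : ‖v‖ ≤ M := by
  have h1 := hv (x + v)
  have h2 := (le_abs_self _).trans (hφ (x + v) x)
  rw [add_sub_cancel_left, real_inner_self_eq_norm_sq] at h1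
  rw [add_sub_cancel_left] at h2
  by_contra! h
  nlinarith

theorem norm_oracleCall_le {f : Fin n → Vec d → ℝ} {g : Fin n → Vec d → Vec d} {M : ℝ}
    (hM : 0 ≤ M) (hf : ∀ i x x', |f i x - f i x'| ≤ M * ‖x - x'‖)
    (hg : IsSubgradientOracle f g) (x : Stack n d) : ‖oracleCall g x‖ ≤ M * √n := by
  apply le_of_sq_le_sq _ (by positivity)
  rw [norm_sq_stack, mul_pow, Real.sq_sqrt (Nat.cast_nonneg n)]
  calc _ ≤ ∑ _i : Fin n, M ^ 2 := Finset.sum_le_sum fun i _ => by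
        have : ‖oracleCall g x i‖ ≤ M := norm_subgradient_le hM (hf i) (hg i (x i))
        gcongr
    _ = _ := by simp [mul_comm]

end Stack

/-! ### Descent of the potential in one outer iteration -/

section Descent

variable {n d : ℕ}

/-- The saddle gap of the averaged iterates of `s` for the Lagrangian
`L(x; y, z) = F(x) + r_x/2 ‖x‖² - ⟪y, x⟫ - G(y, z)`: the value at (primal iterate, `(v, w)`) minus the
value at (`u`, dual iterate). For `z` orthogonal to consensus, maximizing over `y` and `z` gives
`F(x) + r/2 ‖x‖²` at consensus vectors `x` and `+∞` elsewhere. -/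
noncomputable def gap (f : Fin n → Vec d → ℝ) (r : ℝ) (u v w : Stack n d) (s : State n d) : ℝ :=
  (separableSum f s.xBar + rX r / 2 * ‖s.xBar‖ ^ 2 - inner ℝ v s.xBar - G (rYZ r) v w)
    - (separableSum f u + rX r / 2 * ‖u‖ ^ 2 - inner ℝ s.yBar u - G (rYZ r) s.yBar s.zBar)

/-- The potential of the outer iteration, relative to the comparison points `u`, `v`, `w`: the
squared distances of `x`, `y` and of the error-corrected `z`, the squared accumulated error, and the
coupling of the last increment `x̃^k - x^{k-1}` with `y^k - v`. The factor `(k + 2)/3` is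
`(alpha (k - 1))⁻¹`, written so that it makes sense for `k = 0`. -/
noncomputable def potential (r χ : ℝ) (u v w : Stack n d) (k : ℕ) (s : State n d) : ℝ :=
  r / 3 * ((alpha k)⁻¹ ^ 2 * ‖s.x - u‖ ^ 2)
    + r / 6 * (((k + 2) / 3 : ℝ) ^ 2 * ‖s.xTilde - s.xPrev‖ ^ 2)
    - (k + 2) / 3 * inner ℝ (s.xTilde - s.xPrev) (s.y - v)
    + 2 * rYZ r * ‖s.y - v‖ ^ 2
    + 5 * rYZ r * χ ^ 2
      * ‖s.z - ((10 * rYZ r * χ ^ 2)⁻¹ * (alpha k)⁻¹) • disagreement n d s.m - w‖ ^ 2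
    + (10 * rYZ r * χ ^ 2)⁻¹ / 2 * (alpha k)⁻¹ ^ 2 * ‖disagreement n d s.m‖ ^ 2

theorem alpha_inv (k : ℕ) : (alpha k)⁻¹ = (k + 3) / 3 := by rw [alpha, inv_div]

theorem alpha_pos (k : ℕ) : 0 < alpha k := by unfold alpha; positivity

theorem alpha_le_one (k : ℕ) : alpha k ≤ 1 := by
  rw [alpha, div_le_one (by positivity)]
  linarith [(Nat.cast_nonneg k : (0 : ℝ) ≤ k)]

/-- The indefinite coupling term is dominated by two of the squares. -/
theorem potential_nonneg {r : ℝ} (hr : 0 < r) (χ : ℝ) (u v w : Stack n d) (k : ℕ)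
    (s : State n d) : 0 ≤ potential r χ u v w k s := by
  have hR : rYZ r = 3 / r := rfl
  have hR0 : 0 < rYZ r := by rw [hR]; positivity
  have h := (le_abs_self _).trans (abs_inner_le_weighted (c := r / 6) (by positivity)
    (((k + 2) / 3 : ℝ) • (s.xTilde - s.xPrev)) (s.y - v))
  rw [real_inner_smul_left, norm_smul, mul_pow, Real.norm_eq_abs, sq_abs] at h
  have h2 : 1 / (4 * (r / 6)) ≤ 2 * rYZ r := by
    rw [hR, show 1 / (4 * (r / 6)) = 3 / 2 / r by field_simp; norm_num,
      show 2 * (3 / r) = 6 / r by ring]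
    gcongr; norm_num
  have h3 := mul_le_mul_of_nonneg_right h2 (sq_nonneg ‖s.y - v‖)
  unfold potential
  have h4 : 0 ≤ r / 3 * ((alpha k)⁻¹ ^ 2 * ‖s.x - u‖ ^ 2) := by positivity
  have h5 : 0 ≤ 5 * rYZ r * χ ^ 2
      * ‖s.z - ((10 * rYZ r * χ ^ 2)⁻¹ * (alpha k)⁻¹) • disagreement n d s.m - w‖ ^ 2 := by
    positivity
  have h6 : 0 ≤ (10 * rYZ r * χ ^ 2)⁻¹ / 2 * (alpha k)⁻¹ ^ 2 * ‖disagreement n d s.m‖ ^ 2 := by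
    positivity
  linarith

theorem innerLoop_calls (g : Fin n → Vec d → Vec d) (η β τ : ℝ) (y xk : Stack n d) (t : ℕ) :
    (innerLoop g η β τ y xk t).calls = t := by
  induction t with
  | zero => rfl
  | succ t ih => simp only [innerLoop, ih]

theorem iterate_comms (P : Params) (ryz : ℝ) (g : Fin n → Vec d → Vec d) (T : ℕ)
    (Wseq : ℕ → Matrix (Fin n) (Fin n) ℝ) (x y z m : Stack n d) (k : ℕ) :
    (iterate P ryz g T Wseq (State.init x y z m) k).comms = k := by
  induction k with
  | zero => rfl
  | succ k ih => simp only [iterate, step, ih]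

theorem iterate_subgrads (P : Params) (ryz : ℝ) (g : Fin n → Vec d → Vec d) (T : ℕ)
    (Wseq : ℕ → Matrix (Fin n) (Fin n) ℝ) (x y z m : Stack n d) (k : ℕ) :
    (iterate P ryz g T Wseq (State.init x y z m) k).subgrads = k * T := by
  induction k with
  | zero => simp [iterate, State.init]
  | succ k ih => simp only [iterate, step, ih, innerLoop_calls, Nat.succ_mul]

theorem disagreement_step_z (P : Params) (ryz : ℝ) (g : Fin n → Vec d → Vec d) (T : ℕ)
    {W : Matrix (Fin n) (Fin n) ℝ} (hW : Matrix.mulVec W.transpose (fun _ => 1) = 0) (k : ℕ)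
    {s : State n d} (hz : disagreement n d s.z = s.z)
    (hzb : disagreement n d s.zBar = s.zBar) :
    disagreement n d (step P ryz g T W k s).z = (step P ryz g T W k s).z ∧
      disagreement n d (step P ryz g T W k s).zBar = (step P ryz g T W k s).zBar := by
  constructor <;>
    simp only [step, map_sub, map_add, map_smul, disagreement_gossipMul hW, hz, hzb]

/-- Descent in one outer iteration. Up to the error of the inner loop, the gap with weight
`α_k⁻²` plus the potential is at most the gap before the iteration with weight `α_k⁻² - α_k⁻¹` plus
the potential before. -/
theorem step_descent {f : Fin n → Vec d → ℝ} {g : Fin n → Vec d → Vec d} {M r χ : ℝ} {T : ℕ}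
    {W : Matrix (Fin n) (Fin n) ℝ} (hn : 1 ≤ n) (hM : 0 ≤ M) (hr : 0 < r) (hχ : 1 ≤ χ)
    (hT : 1 ≤ T) (hf : ∀ i, ConvexOn ℝ Set.univ (f i))
    (hLip : ∀ i x x', |f i x - f i x'| ≤ M * ‖x - x'‖) (hg : IsSubgradientOracle f g)
    (hW1 : Matrix.mulVec W (fun _ => 1) = 0) (hW2 : Matrix.mulVec W.transpose (fun _ => 1) = 0)
    (hWχ : ∀ x : Fin n → ℝ, ∑ i, x i = 0 →
      ∑ i, (Matrix.mulVec W x i - x i) ^ 2 ≤ (1 - 1 / χ) * ∑ i, x i ^ 2)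
    (u v w : Stack n d) (hw : disagreement n d w = w) (K k : ℕ) (s : State n d)
    (hz : disagreement n d s.z = s.z) :
    (alpha k)⁻¹ ^ 2 * gap f r u v w (step (params r χ K T) (rYZ r) g T W k s)
        + potential r χ u v w (k + 1) (step (params r χ K T) (rYZ r) g T W k s)
      ≤ ((alpha k)⁻¹ ^ 2 - (alpha k)⁻¹) * gap f r u v w s + potential r χ u v w k s
        + 6 * n * M ^ 2 / (r * T) := by
  set s' := step (params r χ K T) (rYZ r) g T W k s
  have hT0 : (0 : ℝ) < T := by exact_mod_cast hT
  have hRdef : rYZ r = 3 / r := rfl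
  have hR : 0 < rYZ r := by rw [hRdef]; positivity
  have hrx : 0 < rX r := by unfold rX; positivity
  have hα := alpha_pos k
  have hα1 := alpha_le_one k
  have ha : 0 < (alpha k)⁻¹ := inv_pos.2 hα
  have ha' : 0 < (alpha (k + 1))⁻¹ := inv_pos.2 (alpha_pos _)
  have hτ : 0 < tauX r k := by unfold tauX; positivity
  have hPA : ∀ x, disagreement n d (gossipMap d W x) = gossipMap d W x :=
    fun x => disagreement_gossipMul hW2 x
  have hAP : ∀ x, gossipMap d W (disagreement n d x) = gossipMap d W x :=
    fun x => gossipMul_disagreement hW1 x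
  have hAχ : ∀ x, ‖gossipMap d W (disagreement n d x) - disagreement n d x‖ ^ 2
      ≤ (1 - 1 / χ) * ‖disagreement n d x‖ ^ 2 := fun x => norm_sq_gossipMul_sub_le hn hWχ x
  set gg : Stack n d := gradG (rYZ r) (alpha k • s.y + (1 - alpha k) • s.yBar)
    (alpha k • s.z + (1 - alpha k) • s.zBar)
  have hx := prox_subgradient_loop (F := separableSum f) (g := oracleCall g)
    (xk := s.x) (p := fun t => (innerLoop g (1 / (tauX r k * T)) (rX r) (tauX r k) s'.y s.x t).point)
    (xt := s'.xTilde) (x' := s'.x) (L := M * √n) hrx.le hτ hT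
    (convexOn_separableSum hf) (separableSum_subgradient hg) (norm_oracleCall_le hM hLip hg)
    (separableSum_sub_le hM hLip) rfl
    (fun t => (eq_proxStep_iff (by positivity) hrx.le hτ.le _ _ _ _ _).1 rfl) rfl rfl u
  have hxBar : s'.xBar = alpha k • s'.xTilde + (1 - alpha k) • s.xBar := rfl
  have hQ : separableSum f s'.xBar + rX r / 2 * ‖s'.xBar‖ ^ 2
      ≤ alpha k * (separableSum f s'.xTilde + rX r / 2 * ‖s'.xTilde‖ ^ 2)
        + (1 - alpha k) * (separableSum f s.xBar + rX r / 2 * ‖s.xBar‖ ^ 2) := by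
    have h1 := (convexOn_separableSum hf).2 (Set.mem_univ s'.xTilde) (Set.mem_univ s.xBar) hα.le
      (sub_nonneg.2 hα1) (by ring)
    have h2 := norm_sub_sq_le_convexComb hα.le hα1 s'.xTilde s.xBar 0
    rw [hxBar]
    simp only [sub_zero, smul_eq_mul] at h1 h2
    nlinarith
  have hG : G (rYZ r) s'.yBar s'.zBar ≤ (1 - alpha k) * G (rYZ r) s.yBar s.zBar
      + alpha k * G (rYZ r) v w + alpha k * inner ℝ gg (s'.y - v) + alpha k * inner ℝ gg (s.z - w)
      + rYZ r * alpha k ^ 2 * ‖s'.y - s.y‖ ^ 2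
      - 1 / (4 * rYZ r * χ) * ‖disagreement n d gg‖ ^ 2 :=
    accelerated_quadratic_step hR hα.le hα1 (a := gossipMap d W gg)
      (half_norm_sq_le_inner_sub _ _ inner_disagreement hPA hAP hAχ gg) v w
  have hzstep := error_feedback_step hR hχ ha ha' (disagreement n d) (gossipMap d W)
    inner_disagreement hPA hAP hAχ gg s.m s.z w hz hw
  have hzeq : s'.z = s.z - ((10 * rYZ r * χ ^ 2)⁻¹ * (alpha k)⁻¹) • gossipMap d W (gg + s.m) := rfl
  have hmeq : s'.m = ((alpha k)⁻¹ / (alpha (k + 1))⁻¹) • (s.m + gg - gossipMap d W (gg + s.m)) := by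
    have : s'.m = (((10 * rYZ r * χ ^ 2)⁻¹ * (alpha k)⁻¹)
      / ((10 * rYZ r * χ ^ 2)⁻¹ * (alpha (k + 1))⁻¹)) • (s.m + gg - gossipMap d W (gg + s.m)) := rfl
    rw [this, mul_div_mul_left _ _ (by positivity)]
  rw [← hzeq, ← hmeq] at hzstep
  set xh := s.x + (((k : ℝ) + 2) / ((k : ℝ) + 3)) • (s.xTilde - s.xPrev) with hxh
  have hyeq : s'.y = s.y - ((4 * rYZ r)⁻¹ * (alpha k)⁻¹) • (gg + xh) := rfl
  have hystep := gradient_step_identity (c := (alpha k)⁻¹) hR.ne' s.y (gg + xh) v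
  rw [← hyeq] at hystep
  have hyBar : s'.yBar = alpha k • s'.y + (1 - alpha k) • s.yBar := by
    have : s'.yBar = alpha k • s.y + (1 - alpha k) • s.yBar + alpha k • (s'.y - s.y) := rfl
    rw [this]; module
  have hxPrev : s'.xPrev = s.x := rfl
  -- the extrapolation makes the coupling terms telescope
  have hcouple : (alpha k)⁻¹ * inner ℝ (s'.xTilde - xh) (s'.y - v)
      = (alpha k)⁻¹ * inner ℝ (s'.xTilde - s'.xPrev) (s'.y - v)
        - (k + 2) / 3 * inner ℝ (s.xTilde - s.xPrev) (s.y - v)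
        - (k + 2) / 3 * inner ℝ (s.xTilde - s.xPrev) (s'.y - s.y) := by
    have e1 : s'.xTilde - xh = (s'.xTilde - s'.xPrev)
        - (((k : ℝ) + 2) / ((k : ℝ) + 3)) • (s.xTilde - s.xPrev) := by
      rw [hxh, hxPrev]; abel
    have e2 : (alpha k)⁻¹ * (((k : ℝ) + 2) / ((k : ℝ) + 3)) = (k + 2) / 3 := by
      rw [alpha_inv]; field_simp
    rw [e1, inner_sub_left, mul_sub, real_inner_smul_left, ← mul_assoc, e2,
      show s'.y - v = (s.y - v) + (s'.y - s.y) by abel, inner_add_right (s.xTilde - s.xPrev)]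
    ring
  have hcouple2 : -((k + 2) / 3 * inner ℝ (s.xTilde - s.xPrev) (s'.y - s.y))
      ≤ r / 6 * (((k + 2) / 3 : ℝ) ^ 2 * ‖s.xTilde - s.xPrev‖ ^ 2)
        + rYZ r * ‖s'.y - s.y‖ ^ 2 := by
    have h := (neg_le_abs _).trans (abs_inner_le_weighted (c := r / 12) (by positivity)
      (((k + 2) / 3 : ℝ) • (s.xTilde - s.xPrev)) (s'.y - s.y))
    rw [real_inner_smul_left, norm_smul, mul_pow, Real.norm_eq_abs, sq_abs,
      show 1 / (4 * (r / 12)) = rYZ r by rw [hRdef]; field_simp; norm_num] at h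
    have : 0 ≤ r / 12 * (((k + 2) / 3 : ℝ) ^ 2 * ‖s.xTilde - s.xPrev‖ ^ 2) := by positivity
    linarith
  -- rescaling of the inequalities by powers of `(alpha k)⁻¹`
  have hnext : (alpha (k + 1))⁻¹ = (alpha k)⁻¹ + 1 / 3 := by
    rw [alpha_inv, alpha_inv]; push_cast; ring
  have ha1 : 1 ≤ (alpha k)⁻¹ := one_le_inv₀ hα |>.2 hα1
  have hτa : tauX r k = r / 3 * (alpha k)⁻¹ := by unfold tauX rX; ring
  have hk3 : (((k + 1 : ℕ) : ℝ) + 2) / 3 = (alpha k)⁻¹ := by rw [alpha_inv]; push_cast; ring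
  have hrx' : rX r = 2 / 3 * r := rfl
  clear_value s' gg xh
  unfold potential gap
  rw [hk3, hnext]
  rw [hnext] at hzstep
  rw [hyBar, inner_add_left, real_inner_smul_left, real_inner_smul_left]
  rw [hyBar] at hG
  rw [hτa] at hx
  have hvx : inner ℝ v s'.xBar = alpha k * inner ℝ v s'.xTilde + (1 - alpha k) * inner ℝ v s.xBar := by
    rw [hxBar, inner_add_right, real_inner_smul_right, real_inner_smul_right]
  rw [hvx]
  have hA : (alpha k)⁻¹ * alpha k = 1 := inv_mul_cancel₀ hα.ne'
  set a := (alpha k)⁻¹ with hadef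
  have hscale : ∀ X Y : ℝ, a ^ 2 * (alpha k * X + (1 - alpha k) * Y) = a * X + (a ^ 2 - a) * Y := by
    intro X Y
    linear_combination (a * X - a * Y) * hA
  have hx2 := mul_le_mul_of_nonneg_left hx ha.le
  have herr : a * (2 * (M * √n) ^ 2 / (r / 3 * a * T)) = 6 * n * M ^ 2 / (r * T) := by
    rw [mul_pow, Real.sq_sqrt (Nat.cast_nonneg n)]
    field_simp
    ring
  rw [mul_add a _ (2 * (M * √n) ^ 2 / (r / 3 * a * T)), herr] at hx2
  have hQ2 := mul_le_mul_of_nonneg_left hQ (sq_nonneg a)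
  rw [hscale] at hQ2
  have hG2 := mul_le_mul_of_nonneg_left hG (sq_nonneg a)
  have hGrhs : a ^ 2 * ((1 - alpha k) * G (rYZ r) s.yBar s.zBar
      + alpha k * G (rYZ r) v w + alpha k * inner ℝ gg (s'.y - v) + alpha k * inner ℝ gg (s.z - w)
      + rYZ r * alpha k ^ 2 * ‖s'.y - s.y‖ ^ 2
      - 1 / (4 * rYZ r * χ) * ‖disagreement n d gg‖ ^ 2)
      = (a ^ 2 - a) * G (rYZ r) s.yBar s.zBar
        + a * (G (rYZ r) v w + inner ℝ gg (s'.y - v) + inner ℝ gg (s.z - w))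
        + rYZ r * ‖s'.y - s.y‖ ^ 2
        - a ^ 2 * (1 / (4 * rYZ r * χ) * ‖disagreement n d gg‖ ^ 2) := by
    linear_combination (a * (G (rYZ r) v w + inner ℝ gg (s'.y - v) + inner ℝ gg (s.z - w))
      - a * G (rYZ r) s.yBar s.zBar + (a * alpha k + 1) * (rYZ r * ‖s'.y - s.y‖ ^ 2)) * hA
  rw [hGrhs] at hG2
  have hv2 := hscale (inner ℝ v s'.xTilde) (inner ℝ v s.xBar)
  have hu2 := hscale (inner ℝ s'.y u) (inner ℝ s.yBar u)
  -- the growth of the primal weight, possible because `a ≥ 1`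
  have hxweight : r / 3 * ((a + 1 / 3) ^ 2 * ‖s'.x - u‖ ^ 2)
      ≤ a * ((r / 3 * a + rX r / 2) * ‖s'.x - u‖ ^ 2) := by
    rw [← mul_assoc, ← mul_assoc]
    refine mul_le_mul_of_nonneg_right ?_ (sq_nonneg _)
    have : 0 ≤ r / 3 * (a / 3 - 1 / 9) := mul_nonneg (by positivity) (by linarith only [ha1])
    rw [hrx']
    linarith only [this]
  rw [hxPrev] at hcouple ⊢
  rw [inner_add_left] at hystep
  rw [inner_sub_left, inner_sub_right s'.xTilde, real_inner_comm s'.y s'.xTilde,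
    real_inner_comm v s'.xTilde] at hcouple
  linarith only [hx2, hQ2, hG2, hv2, hu2, hxweight, hcouple, hcouple2, hystep, hzstep]

end Descent

/-! ### Summation over the outer iterations and averaging -/

section Averaging

variable {n d : ℕ}

/-- The averaging weight `λ_k` for `1 ≤ k < K`: what is left of the gap at iterate `k` when
consecutive descent inequalities are summed. At `k = 0` the value is meaningless and unused. -/
noncomputable def weight (k : ℕ) : ℝ := (alpha (k - 1))⁻¹ ^ 2 + (alpha k)⁻¹ - (alpha k)⁻¹ ^ 2

theorem weight_succ (k : ℕ) :
    weight (k + 1) = (alpha k)⁻¹ ^ 2 + (alpha (k + 1))⁻¹ - (alpha (k + 1))⁻¹ ^ 2 := rfl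

theorem weight_nonneg {k : ℕ} (hk : 1 ≤ k) : 0 ≤ weight k := by
  obtain ⟨j, rfl⟩ := Nat.exists_eq_add_of_le' hk
  have : weight (j + 1) = ((j : ℝ) + 5) / 9 := by
    rw [weight_succ, alpha_inv, alpha_inv]; push_cast; ring
  rw [this]; positivity

/-- The last weight has no following iteration, so it is `α_{K-1}⁻²` instead of `weight K`. -/
theorem sum_lam_smul {V : Type*} [AddCommGroup V] [Module ℝ V] (r χ : ℝ) (N T : ℕ) (φ : ℕ → V) :
    ∑ k ∈ Finset.Icc 1 (N + 1), (params r χ (N + 1) T).lam k • φ k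
      = ∑ k ∈ Finset.Icc 1 N, weight k • φ k + (alpha N)⁻¹ ^ 2 • φ (N + 1) := by
  rw [Finset.sum_Icc_succ_top (by omega)]
  congr 1
  · refine Finset.sum_congr rfl fun k hk => ?_
    have : k ≠ N + 1 := by have := (Finset.mem_Icc.1 hk).2; omega
    simp [params, this, weight]
  · simp [params]

theorem lam_nonneg (r χ : ℝ) {K T k : ℕ} (hk : 1 ≤ k) : 0 ≤ (params r χ K T).lam k := by
  simp only [params]
  split_ifs
  · positivity
  · have := weight_nonneg hk
    simpa [weight] using this

theorem sq_div_six_le_sum_lam (r χ : ℝ) {K : ℕ} (T : ℕ) (hK : 1 ≤ K) :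
    (K : ℝ) ^ 2 / 6 ≤ ∑ k ∈ Finset.Icc 1 K, (params r χ K T).lam k := by
  obtain ⟨N, rfl⟩ := Nat.exists_eq_add_of_le' hK
  have h := sum_lam_smul r χ N T (fun _ => (1 : ℝ))
  simp only [smul_eq_mul, mul_one] at h
  rw [h]
  clear h hK
  induction N with
  | zero => simp [alpha_inv]; norm_num
  | succ N ih =>
    rw [Finset.sum_Icc_succ_top (by omega), weight_succ]
    have h2 : (alpha (N + 1))⁻¹ = ((N : ℝ) + 4) / 3 := by rw [alpha_inv]; push_cast; ring
    have : (0 : ℝ) ≤ N := Nat.cast_nonneg N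
    push_cast at ih ⊢
    nlinarith

/-- The descent inequalities telescope; the gap at the initial state drops out as `α_0 = 1`. -/
theorem sum_gap_le {f : Fin n → Vec d → ℝ} {g : Fin n → Vec d → Vec d} {M r χ : ℝ} {K T : ℕ}
    {Wseq : ℕ → Matrix (Fin n) (Fin n) ℝ} (hn : 1 ≤ n) (hM : 0 ≤ M) (hr : 0 < r) (hχ : 1 ≤ χ)
    (hK : 1 ≤ K) (hT : 1 ≤ T) (hf : ∀ i, ConvexOn ℝ Set.univ (f i))
    (hLip : ∀ i x x', |f i x - f i x'| ≤ M * ‖x - x'‖) (hg : IsSubgradientOracle f g)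
    (hW1 : ∀ k, Matrix.mulVec (Wseq k) (fun _ => 1) = 0)
    (hW2 : ∀ k, Matrix.mulVec (Wseq k).transpose (fun _ => 1) = 0)
    (hWχ : ∀ k, ∀ x : Fin n → ℝ, ∑ i, x i = 0 →
      ∑ i, (Matrix.mulVec (Wseq k) x i - x i) ^ 2 ≤ (1 - 1 / χ) * ∑ i, x i ^ 2)
    {it : ℕ → State n d}
    (hit : it = iterate (params r χ K T) (rYZ r) g T Wseq (State.init 0 0 0 0))
    (u v w : Stack n d) (hw : disagreement n d w = w) :
    (∀ k, disagreement n d (it k).zBar = (it k).zBar) ∧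
    ∑ k ∈ Finset.Icc 1 K, (params r χ K T).lam k * gap f r u v w (it k)
      ≤ r / 3 * ‖u‖ ^ 2 + 2 * rYZ r * ‖v‖ ^ 2 + 5 * rYZ r * χ ^ 2 * ‖w‖ ^ 2
        + K * (6 * n * M ^ 2 / (r * T)) := by
  have hz : ∀ k, disagreement n d (it k).z = (it k).z ∧
      disagreement n d (it k).zBar = (it k).zBar := by
    intro k
    induction k with
    | zero => simp [hit, iterate, State.init]
    | succ k ih =>
      have : it (k + 1) = step (params r χ K T) (rYZ r) g T (Wseq k) k (it k) := by rw [hit]; rfl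
      rw [this]
      exact disagreement_step_z _ _ _ _ (hW2 k) k ih.1 ih.2
  refine ⟨fun k => (hz k).2, ?_⟩
  have hstep : ∀ k, (alpha k)⁻¹ ^ 2 * gap f r u v w (it (k + 1))
        + potential r χ u v w (k + 1) (it (k + 1))
      ≤ ((alpha k)⁻¹ ^ 2 - (alpha k)⁻¹) * gap f r u v w (it k) + potential r χ u v w k (it k)
        + 6 * n * M ^ 2 / (r * T) := by
    intro k
    have : it (k + 1) = step (params r χ K T) (rYZ r) g T (Wseq k) k (it k) := by rw [hit]; rfl
    rw [this]
    exact step_descent hn hM hr hχ hT hf hLip hg (hW1 k) (hW2 k) (hWχ k) u v w hw K k (it k) (hz k).1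
  have h0 : potential r χ u v w 0 (it 0)
      = r / 3 * ‖u‖ ^ 2 + 2 * rYZ r * ‖v‖ ^ 2 + 5 * rYZ r * χ ^ 2 * ‖w‖ ^ 2 := by
    simp [hit, iterate, State.init, potential, alpha_inv]
  have hind : ∀ N : ℕ, ∑ k ∈ Finset.Icc 1 N, weight k * gap f r u v w (it k)
      + (alpha N)⁻¹ ^ 2 * gap f r u v w (it (N + 1)) + potential r χ u v w (N + 1) (it (N + 1))
      ≤ potential r χ u v w 0 (it 0) + (N + 1 : ℕ) * (6 * n * M ^ 2 / (r * T)) := by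
    intro N
    induction N with
    | zero =>
      have h1 := hstep 0
      have h2 : (alpha 0)⁻¹ = 1 := by rw [alpha_inv]; norm_num
      rw [h2] at h1 ⊢
      simp only [Finset.Icc_eq_empty_of_lt (zero_lt_one' ℕ), Finset.sum_empty] at h1 ⊢
      push_cast
      linarith
    | succ N ih =>
      have h1 := hstep (N + 1)
      rw [Finset.sum_Icc_succ_top (by omega), weight_succ]
      push_cast at ih ⊢
      linarith
  obtain ⟨N, rfl⟩ := Nat.exists_eq_add_of_le' hK
  have h1 := hind N
  have h2 := potential_nonneg hr χ u v w (N + 1) (it (N + 1))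
  have h3 := sum_lam_smul r χ N T (fun k => gap f r u v w (it k))
  simp only [smul_eq_mul] at h3
  rw [h3, ← h0]
  linarith

/-- Jensen's inequality for the weighted average `xa`, compared with the consensus vector `c`.
The dual iterates have been eliminated: their values are at most those of the dual maximum, which
for the consensus vector is `r/6 ‖consensus n c‖²`. -/
theorem averaged_gap_le {f : Fin n → Vec d → ℝ} {g : Fin n → Vec d → Vec d} {M r χ : ℝ} {K T : ℕ}
    {Wseq : ℕ → Matrix (Fin n) (Fin n) ℝ} (hn : 1 ≤ n) (hM : 0 ≤ M) (hr : 0 < r) (hχ : 1 ≤ χ)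
    (hK : 1 ≤ K) (hT : 1 ≤ T) (hf : ∀ i, ConvexOn ℝ Set.univ (f i))
    (hLip : ∀ i x x', |f i x - f i x'| ≤ M * ‖x - x'‖) (hg : IsSubgradientOracle f g)
    (hW1 : ∀ k, Matrix.mulVec (Wseq k) (fun _ => 1) = 0)
    (hW2 : ∀ k, Matrix.mulVec (Wseq k).transpose (fun _ => 1) = 0)
    (hWχ : ∀ k, ∀ x : Fin n → ℝ, ∑ i, x i = 0 →
      ∑ i, (Matrix.mulVec (Wseq k) x i - x i) ^ 2 ≤ (1 - 1 / χ) * ∑ i, x i ^ 2)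
    {it : ℕ → State n d}
    (hit : it = iterate (params r χ K T) (rYZ r) g T Wseq (State.init 0 0 0 0))
    {xa : Stack n d} (hxa : xa = (∑ k ∈ Finset.Icc 1 K, (params r χ K T).lam k)⁻¹ •
      ∑ k ∈ Finset.Icc 1 K, (params r χ K T).lam k • (it k).xBar)
    (c : Vec d) (v w : Stack n d) (hw : disagreement n d w = w) :
    separableSum f xa + rX r / 2 * ‖xa‖ ^ 2 - inner ℝ v xa - G (rYZ r) v w
      ≤ separableSum f (consensus n c) + rX r / 2 * (n * ‖c‖ ^ 2) + r / 6 * (n * ‖c‖ ^ 2)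
        + 6 / K ^ 2 * (r / 3 * (n * ‖c‖ ^ 2) + 2 * rYZ r * ‖v‖ ^ 2 + 5 * rYZ r * χ ^ 2 * ‖w‖ ^ 2
          + K * (6 * n * M ^ 2 / (r * T))) := by
  obtain ⟨hzb, hsum⟩ := sum_gap_le hn hM hr hχ hK hT hf hLip hg hW1 hW2 hWχ hit (consensus n c) v w hw
  have hS := sq_div_six_le_sum_lam r χ T hK
  set lam := (params r χ K T).lam with hlam
  set S := ∑ k ∈ Finset.Icc 1 K, lam k with hSdef
  have hK0 : (0 : ℝ) < K := by exact_mod_cast hK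
  have hS0 : 0 < S := lt_of_lt_of_le (by positivity) hS
  have hR : 0 < rYZ r := by unfold rYZ; positivity
  have hrx : 0 < rX r := by unfold rX; positivity
  rw [norm_sq_consensus] at hsum
  set ψ : Stack n d → ℝ := fun x => separableSum f x + rX r / 2 * ‖x‖ ^ 2 + -inner ℝ v x with hψ
  have hconv : ConvexOn ℝ Set.univ ψ := by
    have h1 : ConvexOn ℝ Set.univ (fun x : Stack n d => rX r / 2 * ‖x‖ ^ 2) := by
      simpa using (convexOn_norm_sub_sq (0 : Stack n d)).smul (by positivity : 0 ≤ rX r / 2)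
    have h2 : ConvexOn ℝ Set.univ (fun x : Stack n d => -inner ℝ v x) :=
      ((innerSL ℝ (-v)).toLinearMap.convexOn convex_univ).congr fun v _ => by simp
    exact ((convexOn_separableSum hf).add h1).add h2
  have hJ : S * ψ xa ≤ ∑ k ∈ Finset.Icc 1 K, lam k * ψ (it k).xBar := by
    have := hconv.map_centerMass_le (t := Finset.Icc 1 K) (w := lam) (p := fun k => (it k).xBar)
      (fun k hk => lam_nonneg r χ (Finset.mem_Icc.1 hk).1) hS0 (fun _ _ => Set.mem_univ _)
    simp only [Finset.centerMass, ← hSdef, ← hxa, smul_eq_mul, Function.comp] at this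
    calc S * ψ xa ≤ S * (S⁻¹ * ∑ k ∈ Finset.Icc 1 K, lam k * ψ (it k).xBar) := by gcongr
      _ = _ := mul_inv_cancel_left₀ hS0.ne' _
  -- each dual iterate is dominated by the dual optimum, since `zBar` is orthogonal to consensus
  have hdual : ∀ k, ψ (it k).xBar - G (rYZ r) v w - separableSum f (consensus n c)
      - rX r / 2 * (n * ‖c‖ ^ 2) - r / 6 * (n * ‖c‖ ^ 2) ≤ gap f r (consensus n c) v w (it k) := by
    intro k
    have h1 := inner_consensus_eq_zero hn (hzb k) c
    have h2 := (neg_le_abs _).trans (abs_inner_le_weighted (c := rYZ r / 2) (by positivity)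
      ((it k).yBar + (it k).zBar) (consensus n c))
    rw [inner_add_left, h1, norm_sq_consensus, show 1 / (4 * (rYZ r / 2)) = r / 6 by
      unfold rYZ; field_simp; norm_num] at h2
    unfold gap
    rw [norm_sq_consensus]
    have h3 : G (rYZ r) (it k).yBar (it k).zBar
      = rYZ r / 2 * ‖(it k).yBar + (it k).zBar‖ ^ 2 := rfl
    simp only [hψ]
    linarith
  set B := separableSum f (consensus n c) + rX r / 2 * (n * ‖c‖ ^ 2) + r / 6 * (n * ‖c‖ ^ 2) with hB
  set E := r / 3 * (n * ‖c‖ ^ 2) + 2 * rYZ r * ‖v‖ ^ 2 + 5 * rYZ r * χ ^ 2 * ‖w‖ ^ 2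
          + K * (6 * n * M ^ 2 / (r * T)) with hE
  have hE0 : 0 ≤ E := by positivity
  have h1 : S * (ψ xa - G (rYZ r) v w - B) ≤ E := by
    have h2 : ∑ k ∈ Finset.Icc 1 K, lam k * (ψ (it k).xBar - G (rYZ r) v w - B) ≤ E := by
      refine le_trans (Finset.sum_le_sum fun k hk => ?_) hsum
      refine mul_le_mul_of_nonneg_left ?_ (lam_nonneg r χ (Finset.mem_Icc.1 hk).1)
      have := hdual k
      rw [hB]; linarith
    have h3 : ∑ k ∈ Finset.Icc 1 K, lam k * (ψ (it k).xBar - G (rYZ r) v w - B)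
        = ∑ k ∈ Finset.Icc 1 K, lam k * ψ (it k).xBar - S * (G (rYZ r) v w + B) := by
      rw [hSdef, Finset.sum_mul, ← Finset.sum_sub_distrib]
      exact Finset.sum_congr rfl fun k _ => by ring
    rw [h3] at h2
    linarith
  have h2 : ψ xa - G (rYZ r) v w - B ≤ 6 / K ^ 2 * E := by
    by_contra! h
    have h3 : 0 ≤ 6 / (K : ℝ) ^ 2 * E := by positivity
    have h4 : (K : ℝ) ^ 2 / 6 * (6 / (K : ℝ) ^ 2 * E) = E := by field_simp
    have h5 : E < (K : ℝ) ^ 2 / 6 * (ψ xa - G (rYZ r) v w - B) := by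
      rw [← h4]; gcongr
    have h6 := mul_le_mul_of_nonneg_right hS (h3.trans h.le)
    linarith
  have h3 : ψ xa = separableSum f xa + rX r / 2 * ‖xa‖ ^ 2 - inner ℝ v xa := by
    simp only [hψ]; ring
  linarith

end Averaging

/-! ### From the saddle gap to the objective -/

section Objective

variable {n d : ℕ}

theorem card_mul_objective (hn : 1 ≤ n) (f : Fin n → Vec d → ℝ) (r : ℝ) (x : Vec d) :
    n * objective f r x = separableSum f (consensus n x) + n * (r / 2 * ‖x‖ ^ 2) := by
  have : (n : ℝ) ≠ 0 := by positivity
  unfold objective separableSum consensus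
  rw [mul_add, ← mul_assoc, mul_one_div_cancel this, one_mul]

theorem consensus_sub (x y : Vec d) : consensus n x - consensus n y = consensus n (x - y) := rfl

/-- Comparison with the objective at `0`. -/
theorem norm_minimizer_le {f : Fin n → Vec d → ℝ} {M r : ℝ} (hn : 1 ≤ n) (hM : 0 ≤ M) (hr : 0 < r)
    (hLip : ∀ i x x', |f i x - f i x'| ≤ M * ‖x - x'‖) {c : Vec d}
    (hc : ∀ x, objective f r c ≤ objective f r x) : ‖c‖ ≤ 2 * M / r := by
  have hn0 : (0 : ℝ) < n := by exact_mod_cast hn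
  have h1 := mul_le_mul_of_nonneg_left (hc 0) hn0.le
  rw [card_mul_objective hn, card_mul_objective hn] at h1
  have h2 := separableSum_sub_le hM hLip (consensus n c) (consensus n 0)
  have h3 : ‖consensus n (0 - c)‖ = √n * ‖c‖ := by
    rw [← Real.sqrt_sq (norm_nonneg (consensus n (0 - c))), norm_sq_consensus,
      Real.sqrt_mul (Nat.cast_nonneg n), Real.sqrt_sq (norm_nonneg _), zero_sub, norm_neg]
  rw [consensus_sub, h3, mul_assoc, ← mul_assoc √n, Real.mul_self_sqrt (Nat.cast_nonneg n)] at h2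
  rw [norm_zero] at h1
  have h4 : r / 2 * ‖c‖ ^ 2 ≤ M * ‖c‖ := by
    refine le_of_mul_le_mul_left ?_ hn0
    linarith
  rw [le_div_iff₀ hr]
  by_contra! h
  have h5 : 0 < ‖c‖ := by
    by_contra! h6
    have : ‖c‖ = 0 := le_antisymm h6 (norm_nonneg _)
    rw [this] at h; linarith
  nlinarith

/-- Quadratic growth at a minimizer. Comparing with the midpoint gives the factor `r/4` (the
optimal one is `r/2`), which is enough and avoids a limit. -/
theorem objective_growth {f : Fin n → Vec d → ℝ} {r : ℝ} (hn : 1 ≤ n)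
    (hf : ∀ i, ConvexOn ℝ Set.univ (f i)) {c : Vec d}
    (hc : ∀ x, objective f r c ≤ objective f r x) (x : Vec d) :
    r / 4 * ‖x - c‖ ^ 2 ≤ objective f r x - objective f r c := by
  have hn0 : (0 : ℝ) < n := by exact_mod_cast hn
  have h1 := mul_le_mul_of_nonneg_left (hc ((1 / 2 : ℝ) • x + (1 / 2 : ℝ) • c)) hn0.le
  have h2 : separableSum f (consensus n ((1 / 2 : ℝ) • x + (1 / 2 : ℝ) • c))
      ≤ 1 / 2 * separableSum f (consensus n x) + 1 / 2 * separableSum f (consensus n c) :=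
    (convexOn_separableSum hf).2 (Set.mem_univ (consensus n x)) (Set.mem_univ (consensus n c))
      (by norm_num) (by norm_num) (by norm_num)
  have h3 : ‖(1 / 2 : ℝ) • x + (1 / 2 : ℝ) • c‖ ^ 2
      = 1 / 2 * ‖x‖ ^ 2 + 1 / 2 * ‖c‖ ^ 2 - 1 / 4 * ‖x - c‖ ^ 2 := by
    rw [norm_sub_sq_real, norm_add_sq_real, norm_smul, norm_smul, real_inner_smul_left,
      real_inner_smul_right]
    norm_num
    ring
  refine le_of_mul_le_mul_left ?_ hn0
  rw [card_mul_objective hn, card_mul_objective hn, h3] at h1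
  rw [mul_sub, card_mul_objective hn, card_mul_objective hn]
  linarith

/-- A bounded dual vector whose product with `x` outweighs the loss in `∑ i, f_i` caused by
replacing the blocks of `x` by their mean. It replaces a Lagrange multiplier of the consensus
constraint. -/
theorem exists_disagreement_penalty {M : ℝ} (hn : 1 ≤ n) (hM : 0 ≤ M) (x : Stack n d) :
    ∃ w : Stack n d, disagreement n d w = w ∧ inner ℝ w x = M * √n * ‖disagreement n d x‖ ∧
      ‖w‖ ^ 2 ≤ n * M ^ 2 := by
  set q := disagreement n d x with hq
  have hqq : disagreement n d q = q := disagreement_eq_self (sum_disagreement hn x)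
  -- if `q = 0`, division by zero makes this vector `0`, as it should be
  refine ⟨(M * √n / ‖q‖) • q, by rw [map_smul, hqq], ?_, ?_⟩
  · have h1 : inner ℝ q x = ‖q‖ ^ 2 := by
      rw [← real_inner_self_eq_norm_sq, ← hqq, inner_disagreement, hqq]
    rw [real_inner_smul_left, h1]
    rcases eq_or_ne ‖q‖ 0 with h | h
    · simp [h]
    · field_simp
  · have h1 : ‖(M * √n / ‖q‖) • q‖ ≤ M * √n := by
      rw [norm_smul, Real.norm_eq_abs, abs_of_nonneg (by positivity)]
      rcases eq_or_ne ‖q‖ 0 with h | h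
      · rw [h, mul_zero]; positivity
      · rw [div_mul_cancel₀ _ h]
    calc _ ≤ (M * √n) ^ 2 := by gcongr
      _ = n * M ^ 2 := by rw [mul_pow, Real.sq_sqrt (Nat.cast_nonneg n), mul_comm]

/-- The rate of convergence of the algorithm. The dual comparison point is chosen as
`w` from `exists_disagreement_penalty` and `v = -(r/3) c - w`. With `v + w = -(r/3) c` the linearization of
`r/6 ‖x‖²` at the minimizer `c` replaces that term, which keeps `v` bounded independently of the
output; the loss `r/6 ‖xo - c‖²` is recovered from `objective_growth`. -/
theorem objective_output_le {f : Fin n → Vec d → ℝ} {g : Fin n → Vec d → Vec d} {M r χ : ℝ}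
    {K T : ℕ} {Wseq : ℕ → Matrix (Fin n) (Fin n) ℝ} (hn : 1 ≤ n) (hM : 0 ≤ M) (hr : 0 < r)
    (hχ : 1 ≤ χ) (hK : 1 ≤ K) (hT : 1 ≤ T) (hf : ∀ i, ConvexOn ℝ Set.univ (f i))
    (hLip : ∀ i x x', |f i x - f i x'| ≤ M * ‖x - x'‖) (hg : IsSubgradientOracle f g)
    (hW1 : ∀ k, Matrix.mulVec (Wseq k) (fun _ => 1) = 0)
    (hW2 : ∀ k, Matrix.mulVec (Wseq k).transpose (fun _ => 1) = 0)
    (hWχ : ∀ k, ∀ x : Fin n → ℝ, ∑ i, x i = 0 →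
      ∑ i, (Matrix.mulVec (Wseq k) x i - x i) ^ 2 ≤ (1 - 1 / χ) * ∑ i, x i ^ 2)
    {c : Vec d} (hc : ∀ x, objective f r c ≤ objective f r x) :
    objective f r (algorithm (params r χ K T) (rYZ r) g K T Wseq 0 0 0 0).point - objective f r c
      ≤ 612 * (χ ^ 2 * M ^ 2 / (r * K ^ 2)) + 108 * (M ^ 2 / (r * (K * T))) := by
  have hn0 : (0 : ℝ) < n := by exact_mod_cast hn
  have hK0 : (0 : ℝ) < K := by exact_mod_cast hK
  have hT0 : (0 : ℝ) < T := by exact_mod_cast hT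
  set it := iterate (params r χ K T) (rYZ r) g T Wseq (State.init 0 0 0 0) with hit
  set xa : Stack n d := (∑ k ∈ Finset.Icc 1 K, (params r χ K T).lam k)⁻¹ •
      ∑ k ∈ Finset.Icc 1 K, (params r χ K T).lam k • (it k).xBar with hxa
  set xo : Vec d := (1 / (n : ℝ)) • ∑ i, xa i with hxo
  have hout : (algorithm (params r χ K T) (rYZ r) g K T Wseq 0 0 0 0).point = xo := rfl
  rw [hout]
  have hR : rYZ r = 3 / r := rfl
  set q := disagreement n d xa with hq
  obtain ⟨w, hw, hwx, hwn⟩ := exists_disagreement_penalty hn hM xa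
  set v : Stack n d := -((r / 3) • consensus n c) - w with hvdef
  have hmain := averaged_gap_le hn hM hr hχ hK hT hf hLip hg hW1 hW2 hWχ hit hxa c v w hw
  -- from here on only the bound `hmain` on the averaged iterate matters
  clear_value xa
  have hcx : ∀ b : Vec d, inner ℝ (consensus n b) xa = n * inner ℝ b xo := by
    intro b
    rw [hxo, real_inner_smul_right, inner_sum, ← mul_assoc, mul_one_div_cancel hn0.ne', one_mul,
      inner_stack]
    rfl
  have hqx : xa - consensus n xo = q := rfl
  have hF := separableSum_sub_le hM hLip xa (consensus n xo)
  rw [norm_sub_rev, hqx] at hF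
  have hnorm : n * ‖xo‖ ^ 2 ≤ ‖xa‖ ^ 2 := by
    have h1 := sq_nonneg ‖xa - consensus n xo‖
    rw [norm_sub_sq_real, real_inner_comm, hcx, norm_sq_consensus, real_inner_self_eq_norm_sq] at h1
    linarith
  have hvx : inner ℝ v xa = -(r / 3 * (n * inner ℝ c xo)) - M * √n * ‖q‖ := by
    rw [hvdef, inner_sub_left, inner_neg_left, real_inner_smul_left, hcx, hwx]
  have hGv : G (rYZ r) v w = r / 6 * (n * ‖c‖ ^ 2) := by
    have : v + w = -((r / 3) • consensus n c) := by rw [hvdef]; abel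
    rw [G, this, norm_neg, norm_smul, mul_pow, Real.norm_eq_abs, sq_abs, norm_sq_consensus, hR]
    field_simp
    ring
  have hcn : r ^ 2 * ‖c‖ ^ 2 ≤ 4 * M ^ 2 := by
    have h1 := norm_minimizer_le hn hM hr hLip hc
    rw [le_div_iff₀ hr] at h1
    nlinarith [norm_nonneg c, mul_nonneg (norm_nonneg c) hr.le]
  have hvn : ‖v‖ ^ 2 ≤ 26 / 9 * (n * M ^ 2) := by
    have h1 : ‖v‖ ^ 2 = r ^ 2 / 9 * (n * ‖c‖ ^ 2) + ‖w‖ ^ 2 := by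
      rw [hvdef, norm_sub_sq_real, inner_neg_left, real_inner_smul_left, real_inner_comm,
        inner_consensus_eq_zero hn hw, norm_neg, norm_smul, mul_pow, Real.norm_eq_abs, sq_abs,
        norm_sq_consensus]
      ring
    have h2 := mul_le_mul_of_nonneg_left hcn hn0.le
    have h3 : 0 ≤ n * M ^ 2 := by positivity
    linarith only [h1, h2, h3, hwn]
  have hE : r / 3 * (n * ‖c‖ ^ 2) + 2 * rYZ r * ‖v‖ ^ 2 + 5 * rYZ r * χ ^ 2 * ‖w‖ ^ 2
      ≤ 34 * (n * (χ ^ 2 * M ^ 2) / r) := by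
    have hχ2 : n * M ^ 2 ≤ n * (χ ^ 2 * M ^ 2) := by
      have : 1 ≤ χ ^ 2 := one_le_pow₀ hχ
      have h3 : 0 ≤ n * M ^ 2 := by positivity
      nlinarith
    have h1 := mul_le_mul_of_nonneg_left hcn hn0.le
    have h2 := mul_le_mul_of_nonneg_left hwn (sq_nonneg χ)
    rw [hR, ← mul_div_assoc 34, le_div_iff₀ hr]
    have : (r / 3 * (n * ‖c‖ ^ 2) + 2 * (3 / r) * ‖v‖ ^ 2 + 5 * (3 / r) * χ ^ 2 * ‖w‖ ^ 2) * r
        = n * (r ^ 2 * ‖c‖ ^ 2) / 3 + 6 * ‖v‖ ^ 2 + 15 * (χ ^ 2 * ‖w‖ ^ 2) := by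
      field_simp
      ring
    rw [this]
    have h3 : 0 ≤ n * M ^ 2 := by positivity
    linarith only [h1, h2, h3, hχ2, hvn]
  have hgrow := objective_growth hn hf hc xo
  have hdiff : n * (objective f r xo - objective f r c) - n * (r / 6 * ‖xo - c‖ ^ 2)
      ≤ n * (204 * (χ ^ 2 * M ^ 2 / (r * K ^ 2)) + 36 * (M ^ 2 / (r * (K * T)))) := by
    have h1 : 6 / (K : ℝ) ^ 2 * (34 * (n * (χ ^ 2 * M ^ 2) / r) + K * (6 * n * M ^ 2 / (r * T)))
        = n * (204 * (χ ^ 2 * M ^ 2 / (r * K ^ 2)) + 36 * (M ^ 2 / (r * (K * T)))) := by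
      field_simp
      ring
    rw [← h1]
    have h2 := mul_le_mul_of_nonneg_left (add_le_add_left hE (K * (6 * n * M ^ 2 / (r * T))))
      (by positivity : 0 ≤ 6 / (K : ℝ) ^ 2)
    have hrx : rX r = 2 / 3 * r := rfl
    have h3 := mul_le_mul_of_nonneg_left hnorm hr.le
    rw [hvx, hGv, hrx] at hmain
    rw [mul_sub, card_mul_objective hn, card_mul_objective hn, norm_sub_sq_real,
      real_inner_comm]
    linarith only [hmain, h2, h3, hF]
  have h1 : objective f r xo - objective f r c - r / 6 * ‖xo - c‖ ^ 2
      ≤ 204 * (χ ^ 2 * M ^ 2 / (r * K ^ 2)) + 36 * (M ^ 2 / (r * (K * T))) := by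
    refine le_of_mul_le_mul_left ?_ hn0
    linarith
  linarith

end Objective

/-! ### Choice of the iteration counts -/

section Parameters

theorem exists_iteration_counts {M r χ ε : ℝ} (hM : 0 ≤ M) (hr : 0 < r) (hχ : 1 ≤ χ) (hε : 0 < ε) :
    ∃ K T : ℕ, 1 ≤ K ∧ 1 ≤ T ∧
      36 * (χ * M / √(r * ε)) ≤ K ∧ 216 * (M ^ 2 / (r * ε)) ≤ K * T ∧
      (K : ℝ) ≤ 36 * (χ * M / √(r * ε)) + 1 ∧ (K : ℝ) * T ≤ 216 * (M ^ 2 / (r * ε)) + K := by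
  have key : ∀ b : ℝ, 0 ≤ b → ∃ N : ℕ, 1 ≤ N ∧ b ≤ N ∧ (N : ℝ) ≤ b + 1 := by
    intro b hb
    refine ⟨max 1 ⌈b⌉₊, le_max_left _ _, (Nat.le_ceil b).trans ?_, ?_⟩
    · exact_mod_cast le_max_right _ _
    · push_cast
      exact max_le (by linarith) (Nat.ceil_lt_add_one hb).le
  obtain ⟨K, hK1, hK2, hK3⟩ := key (36 * (χ * M / √(r * ε))) (by positivity)
  have hK0 : (0 : ℝ) < K := by exact_mod_cast hK1
  obtain ⟨T, hT1, hT2, hT3⟩ := key (216 * (M ^ 2 / (r * ε)) / K) (by positivity)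
  refine ⟨K, T, hK1, hT1, hK2, ?_, hK3, ?_⟩
  · rw [div_le_iff₀ hK0] at hT2; linarith
  · have := mul_le_mul_of_nonneg_left hT3 hK0.le
    rwa [mul_add, mul_one, mul_div_cancel₀ _ hK0.ne'] at this

end Parameters

end DecOpt

theorem theorem3 :
    ∃ C : ℝ, 0 < C ∧
      ∀ M r χ ε : ℝ, 0 ≤ M → 0 < r → 1 ≤ χ → 0 < ε →
        ∃ K T : ℕ, 1 ≤ K ∧ 1 ≤ T ∧
          (K : ℝ) ≤ C * (χ * M / Real.sqrt (r * ε)) + 1 ∧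
          (K : ℝ) * T ≤ C * (M ^ 2 / (r * ε)) + K ∧
          (χ * Real.sqrt (r * ε) ≤ M →
            (K : ℝ) ≤ C * (χ * M / Real.sqrt (r * ε)) ∧
            (K : ℝ) * T ≤ C * (M ^ 2 / (r * ε))) ∧
          ∀ (n d : ℕ), 1 ≤ n →
            ∀ (f : Fin n → DecOpt.Vec d → ℝ) (g : Fin n → DecOpt.Vec d → DecOpt.Vec d)
              (E : ℝ → Set (Fin n × Fin n)) (W : ℝ → Matrix (Fin n) (Fin n) ℝ)
              (time : ℕ → ℝ) (xstar : DecOpt.Vec d),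
              (∀ i, ConvexOn ℝ Set.univ (f i)) →
              (∀ i x x', |f i x - f i x'| ≤ M * ‖x - x'‖) →
              (∀ x, DecOpt.objective f r xstar ≤ DecOpt.objective f r x) →
              DecOpt.IsSubgradientOracle f g →
              DecOpt.IsGossip E W →
              DecOpt.HasConditionNumber W χ →
              (∀ k, 0 ≤ time k) →
              let out := DecOpt.algorithm (DecOpt.params r χ K T) (DecOpt.rYZ r) g K T
                (fun k => W (time k)) 0 0 0 0
              out.comms = K ∧ out.subgrads = K * T ∧
                DecOpt.objective f r out.point - DecOpt.objective f r xstar ≤ ε := by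
  refine ⟨253, by norm_num, fun M r χ ε hM hr hχ hε => ?_⟩
  obtain ⟨K, T, hK, hT, hK1, hT1, hK2, hT2⟩ := DecOpt.exists_iteration_counts hM hr hχ hε
  have hK0 : (0 : ℝ) < K := by exact_mod_cast hK
  have hT0 : (0 : ℝ) < T := by exact_mod_cast hT
  have hs : 0 < √(r * ε) := by positivity
  have hsq : √(r * ε) ^ 2 = r * ε := Real.sq_sqrt (by positivity)
  have hb : 0 ≤ χ * M / √(r * ε) := by positivity
  have hm : 0 ≤ M ^ 2 / (r * ε) := by positivity
  refine ⟨K, T, hK, hT, by linarith, by linarith, fun h => ?_, ?_⟩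
  · have ht : χ ≤ M / √(r * ε) := by rwa [le_div_iff₀ hs]
    have h1 : χ * M / √(r * ε) = χ * (M / √(r * ε)) := mul_div_assoc _ _ _
    have h2 : M ^ 2 / (r * ε) = (M / √(r * ε)) ^ 2 := by rw [div_pow, hsq]
    have h3 : 1 ≤ χ * (M / √(r * ε)) := by nlinarith
    have h4 : χ * (M / √(r * ε)) ≤ (M / √(r * ε)) ^ 2 := by nlinarith
    rw [h1] at hK2 ⊢
    rw [h2] at hT2 ⊢
    constructor <;> linarith
  · intro n d hn f g E W time xstar hf hLip hmin hg hW hWχ htime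
    refine ⟨DecOpt.iterate_comms _ _ _ _ _ _ _ _ _ _, DecOpt.iterate_subgrads _ _ _ _ _ _ _ _ _ _,
      (DecOpt.objective_output_le hn hM hr hχ hK hT hf hLip hg (fun k => hW.mulVec_one _ (htime k))
        (fun k => hW.transpose_mulVec_one _ (htime k)) (fun k => hWχ _ (htime k)) hmin).trans ?_⟩
    have h1 : 612 * (χ ^ 2 * M ^ 2 / (r * K ^ 2)) ≤ ε / 2 := by
      rw [← mul_div_assoc, div_le_iff₀ hs] at hK1
      have h2 := mul_self_le_mul_self (by positivity) hK1
      have h3 : (K * √(r * ε)) * (K * √(r * ε)) = K ^ 2 * (r * ε) := by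
        linear_combination (K : ℝ) ^ 2 * hsq
      rw [h3] at h2
      rw [← mul_div_assoc, div_le_iff₀ (by positivity)]
      nlinarith [sq_nonneg (χ * M)]
    have h2 : 108 * (M ^ 2 / (r * (K * T))) ≤ ε / 2 := by
      rw [← mul_div_assoc, div_le_iff₀ (by positivity)] at hT1
      rw [← mul_div_assoc, div_le_iff₀ (by positivity)]
      linarith
    linarith
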